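/- Let $\alpha>-1$ and let $d\mu_\alpha(x)=x^{2\alpha+1}\,dx$ on $\mathbb R_+=(0,\infty)$. Let $J_\alpha$ be the Bessel function of the first kind, $\psi^\alpha_\lambda(x)=\sqrt{x\lambda}\,J_\alpha(x\lambda)$ and $\Psi^\alpha_\lambda(x)=(x\lambda)^{-\alpha}J_\alpha(x\lambda)$ for $x,\lambda>0$. The modified Hankel transform of $f\in L^2(\mu_\alpha)$ is $$h_\alpha f(\lambda)=\int_0^\infty \Psi^\alpha_\lambda(x)f(x)\,d\mu_\alpha(x),$$ understood as the limit in $L^2(\mu_\alpha)$, as $R\to\infty$, of the integrals over $(0,R]$. The Bessel heat semigroup on $L^2(\mu_\alpha)$ is defined by $$T^{\alpha,\Psi}_tf=h_\alpha\big(e^{-t(\cdot)^2}h_\alpha f\big),\qquad t\ge 0,\ f\in L^2(\mu_\alpha),$$ and it is extended to $L^1(\mu_\alpha)+L^\infty(\mu_\alpha)$ by $T^{\alpha,\Psi}_0=\mathrm{Id}$ and, for $t>0$, $$T^{\alpha,\Psi}_tf(x)=\int_0^\infty G^{\alpha,\Psi}_t(x,y)f(y)\,d\mu_\alpha(y),\qquad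 G^{\alpha,\Psi}_t(x,y)=(xy)^{-(\alpha+1/2)}\int_0^\infty e^{-t\lambda^2}\psi^\alpha_\lambda(x)\psi^\alpha_\lambda(y)\,d\lambda,\qquad x,y>0.$$ Then these objects are well defined (the limit defining $h_\alpha f$ exists for every $f\in L^2(\mu_\alpha)$; the integral defining $T^{\alpha,\Psi}_tf(x)$ converges absolutely for all $t>0$, $x>0$, $f\in L^1(\mu_\alpha)+L^\infty(\mu_\alpha)$; and both definitions of $T^{\alpha,\Psi}_t$ agree on $L^2(\mu_\alpha)$ for every $t\ge0$), and $\{T^{\alpha,\Psi}_t\}_{t\ge 0}$ is a Markovian symmetric diffusion semigroup. This means that the $T_t=T^{\alpha,\Psi}_t$ are linear operators from $L^1(\mu_\alpha)+L^\infty(\mu_\alpha)$ to the measurable functions modulo equality almost everywhere, with $T_0=\mathrm{Id}$, such that (i) for each $1\le p\le\infty$, every $T_t$ is a contraction on $L^p(\mu_\alpha)$, and $T_{s+t}=T_sT_t$ there for all $s,t\ge 0$; (ii) each $T_t$ is self-adjoint on $L^2(\mu_\alpha)$; (iii) $\lim_{t\to0^+}T_tf=f$ in $L^2(\mu_\alpha)$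 for each $f\in L^2(\mu_\alpha)$; (iv) $T_tf\ge0$ whenever $f\ge0$, for each $f\in L^1(\mu_\alpha)+L^\infty(\mu_\alpha)$ and each $t\ge0$; (v) $T_t\mathbf 1=\mathbf 1$ for all $t\ge0$. The functions may be real- or complex-valued. -/

import Mathlib

open MeasureTheory Filter Set
open scoped Topology NNReal ENNReal ComplexOrder

noncomputable section

section Abstract

variable {X : Type*} [MeasurableSpace X] {𝕜 : Type*} [RCLike 𝕜]

/-- Membership of a function in `L¹(μ) + L^∞(μ)`. -/
def MemL1AddLinf (μ : Measure X) (f : X → 𝕜) : Prop :=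
  ∃ g h : X → 𝕜, MemLp g 1 μ ∧ MemLp h ∞ μ ∧ f =ᵐ[μ] g + h

/-- `T` is a symmetric diffusion semigroup on the `σ`-finite measure space `(X, μ)`, acting on
`𝒟 = L¹(μ) + L^∞(μ)`.  Elements of function spaces are represented by functions, and all
identities are understood almost everywhere; `congr_ae` says that `T t` acts on classes of
functions modulo equality almost everywhere. -/
structure IsSymmetricDiffusionSemigroup (μ : Measure X) [SigmaFinite μ]
    (T : ℝ≥0 → (X → 𝕜) → (X → 𝕜)) : Prop where
  congr_ae : ∀ t f g, MemL1AddLinf μ f → f =ᵐ[μ] g → T t f =ᵐ[μ] T t g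
  /-- `T t` maps `𝒟` to measurable functions. -/
  aestronglyMeasurable : ∀ t f, MemL1AddLinf μ f → AEStronglyMeasurable (T t f) μ
  map_add : ∀ t f g, MemL1AddLinf μ f → MemL1AddLinf μ g →
    T t (f + g) =ᵐ[μ] T t f + T t g
  map_smul : ∀ t (c : 𝕜) f, MemL1AddLinf μ f → T t (c • f) =ᵐ[μ] c • T t f
  map_zero_time : ∀ f, MemL1AddLinf μ f → T 0 f =ᵐ[μ] f
  /-- Each `T t` is a contraction on `L^p`, `1 ≤ p ≤ ∞`. -/
  contraction : ∀ t (p : ℝ≥0∞), 1 ≤ p → ∀ f, MemLp f p μ →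
    MemLp (T t f) p μ ∧ eLpNorm (T t f) p μ ≤ eLpNorm f p μ
  /-- The semigroup law on `L^p`, `1 ≤ p ≤ ∞`. -/
  semigroup : ∀ s t (p : ℝ≥0∞), 1 ≤ p → ∀ f, MemLp f p μ → T (s + t) f =ᵐ[μ] T s (T t f)
  /-- Each `T t` (everywhere defined and bounded on `L²` by `contraction`) is self-adjoint. -/
  selfAdjoint : ∀ t f g, MemLp f 2 μ → MemLp g 2 μ →
    ∫ x, inner 𝕜 (T t f x) (g x) ∂μ = ∫ x, inner 𝕜 (f x) (T t g x) ∂μ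
  /-- Strong continuity at `0` in `L²`. -/
  tendsto_zero : ∀ f, MemLp f 2 μ →
    Tendsto (fun t : ℝ≥0 => eLpNorm (T t f - f) 2 μ) (𝓝[>] 0) (𝓝 0)

/-- A Markovian symmetric diffusion semigroup: positive and conservative. -/
structure IsMarkovianSymmetricDiffusionSemigroup (μ : Measure X) [SigmaFinite μ]
    (T : ℝ≥0 → (X → 𝕜) → (X → 𝕜)) : Prop extends IsSymmetricDiffusionSemigroup μ T where
  nonneg : ∀ t f, MemL1AddLinf μ f → 0 ≤ᵐ[μ] f → 0 ≤ᵐ[μ] T t f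
  conservative : ∀ t, T t (fun _ => 1) =ᵐ[μ] fun _ => 1

end Abstract

/-- The Bessel function of the first kind `J_ν(z)`, `z > 0`. -/
def besselJ (ν z : ℝ) : ℝ :=
  (z / 2) ^ ν * ∑' k : ℕ, (-1) ^ k / (k.factorial * Real.Gamma (k + ν + 1)) * (z / 2) ^ (2 * k)

/-- The measure `dμ_α(x) = x^{2α+1} dx` on the half-line `(0, ∞)`. -/
def besselMeasure (α : ℝ) : Measure ℝ :=
  (volume.restrict (Ioi 0)).withDensity fun x => ENNReal.ofReal (x ^ (2 * α + 1))

instance besselMeasure_sigmaFinite (α : ℝ) : SigmaFinite (besselMeasure α) := by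
  unfold besselMeasure
  infer_instance

/-- `Ψ^α_l(x) = (x l)^{-α} J_α(x l)`. -/
def besselPsi (α l x : ℝ) : ℝ := (x * l) ^ (-α) * besselJ α (x * l)

/-- `ψ^α_l(x) = √(x l) J_α(x l)`. -/
def besselPsi0 (α l x : ℝ) : ℝ := √(x * l) * besselJ α (x * l)

/-- The heat kernel `G^{α,ψ}_t(x, y) = ∫₀^∞ e^{-t l²} ψ^α_l(x) ψ^α_l(y) dl`. -/
def besselKernel0 (α t x y : ℝ) : ℝ :=
  ∫ l in Ioi (0 : ℝ), Real.exp (-t * l ^ 2) * besselPsi0 α l x * besselPsi0 α l y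

/-- The heat kernel `G^{α,Ψ}_t(x, y) = (x y)^{-(α+1/2)} G^{α,ψ}_t(x, y)`. -/
def besselKernel (α t x y : ℝ) : ℝ := (x * y) ^ (-(α + 1 / 2)) * besselKernel0 α t x y

section Operators

variable {𝕜 : Type*} [RCLike 𝕜]

/-- The truncated modified Hankel transform `∫₀^R Ψ^α_l(x) f(x) dμ_α(x)`. -/
def modHankelTrunc (α R : ℝ) (f : ℝ → 𝕜) (l : ℝ) : 𝕜 :=
  ∫ x in Ioc 0 R, besselPsi α l x • f x ∂(besselMeasure α)

/-- `g` is the modified Hankel transform of `f ∈ L²(μ_α)`: the `L²(μ_α)`-limit as `R → ∞` of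
the truncated integrals. -/
def IsModHankel (α : ℝ) (f g : ℝ → 𝕜) : Prop :=
  MemLp g 2 (besselMeasure α) ∧
    Tendsto (fun R => eLpNorm (modHankelTrunc α R f - g) 2 (besselMeasure α)) atTop (𝓝 0)

open Classical in
/-- The modified Hankel transform `h_α` on `L²(μ_α)` (determined up to a null set). -/
def modHankel (α : ℝ) (f : ℝ → 𝕜) : ℝ → 𝕜 :=
  if h : ∃ g, IsModHankel α f g then h.choose else 0

/-- The semigroup on `L²(μ_α)`, defined spectrally: `h_α (e^{-t l²} h_α f)`. -/
def besselHeatL2 (α : ℝ) (t : ℝ≥0) (f : ℝ → 𝕜) : ℝ → 𝕜 :=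
  modHankel α fun l => Real.exp (-t * l ^ 2) • modHankel α f l

/-- The semigroup on `L¹(μ_α) + L^∞(μ_α)`, given by the heat kernel for `t > 0` and the
identity for `t = 0`. -/
def besselHeat (α : ℝ) (t : ℝ≥0) (f : ℝ → 𝕜) : ℝ → 𝕜 :=
  if t = 0 then f else fun x => ∫ y, besselKernel α t x y • f y ∂(besselMeasure α)

end Operators

end

/-! Everything is tested on the Gaussians exp (-a x²), by two principles. First, Gaussian integrals
with a ≥ c determine a function up to null sets (`ae_eq_zero_of_integral_exp_neg_sq`, from
Stone–Weierstrass). Second, the operators act on Gaussians explicitly: the Hankel transform sends a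
to 1/(4a) with factor (2a)^(-α-1), and the heat kernel sends a to a/(1+4at) with factor
(1+4at)^(-α-1). Both rules come from `integral_exp_neg_mul_besselEntire`, a termwise integration in
which the Gaussian moments cancel the Gamma factors of the Bessel series. Thus the
Chapman–Kolmogorov identity, Weber's second integral and the agreement of the two definitions on L²
become algebra in the parameters.

The explicit kernel `besselHeatKernel` is symmetric, nonnegative (a power series with positive
coefficients at a nonnegative argument) and of mass one (the case a = 0). Contractivity,
self-adjointness, positivity and conservation then hold as for any symmetric Markov kernel, and
Chapman–Kolmogorov gives the semigroup law.

On the span of the Gaussians, which is dense in L², the Hankel transform preserves inner products;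
it extends to an involutive contraction `hankelL2`, identified with the truncated integrals by
Fubini against Gaussians. Strong continuity at 0 follows from T_t f - f = h((exp (-t l²) - 1) h f)
and dominated convergence. -/

lemma measurable_besselDensity (α : ℝ) :
    Measurable fun x : ℝ => ENNReal.ofReal (x ^ (2 * α + 1)) := by fun_prop

lemma ae_besselMeasure_pos (α : ℝ) : ∀ᵐ x ∂(besselMeasure α), 0 < x := by
  refine (withDensity_absolutelyContinuous _ _).ae_le ?_
  exact ae_restrict_mem measurableSet_Ioi

lemma integral_besselMeasure {E : Type*} [NormedAddCommGroup E] [NormedSpace ℝ E] (α : ℝ)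
    (f : ℝ → E) :
    ∫ x, f x ∂(besselMeasure α) = ∫ x in Ioi (0 : ℝ), x ^ (2 * α + 1) • f x := by
  rw [besselMeasure, integral_withDensity_eq_integral_toReal_smul (measurable_besselDensity α)
    (by simp)]
  refine setIntegral_congr_fun measurableSet_Ioi fun x hx => ?_
  have hx' : (0 : ℝ) < x := hx
  rw [ENNReal.toReal_ofReal (by positivity)]

lemma integrable_besselMeasure_iff {E : Type*} [NormedAddCommGroup E] [NormedSpace ℝ E] (α : ℝ)
    (f : ℝ → E) :
    Integrable f (besselMeasure α) ↔
      IntegrableOn (fun x => x ^ (2 * α + 1) • f x) (Ioi (0 : ℝ)) := by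
  rw [besselMeasure, integrable_withDensity_iff_integrable_smul' (measurable_besselDensity α)
    (by simp)]
  refine integrable_congr ?_
  filter_upwards [ae_restrict_mem measurableSet_Ioi] with x hx
  have hx' : (0 : ℝ) < x := hx
  rw [ENNReal.toReal_ofReal (by positivity)]

/-! ### Uniqueness from Gaussian integrals -/

/-- Finite measures on `ℝ≥0` are determined by the integrals of the functions `exp (-n x²)`. -/
lemma NNReal.measure_ext_of_integral_exp_neg_sq {P Q : Measure ℝ≥0} [IsFiniteMeasure P]
    [IsFiniteMeasure Q]
    (h : ∀ n : ℕ, ∫ x : ℝ≥0, Real.exp (-(n * (x : ℝ) ^ 2)) ∂P =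
      ∫ x : ℝ≥0, Real.exp (-(n * (x : ℝ) ^ 2)) ∂Q) : P = Q := by
  let b : BoundedContinuousFunction ℝ≥0 ℝ :=
    BoundedContinuousFunction.ofNormedAddCommGroup (fun x : ℝ≥0 => Real.exp (-(x : ℝ) ^ 2))
      (by fun_prop) 1 (fun x => by
        rw [Real.norm_of_nonneg (Real.exp_nonneg _)]
        exact Real.exp_le_one_iff.2 (by have := sq_nonneg (x : ℝ); linarith))
  have hb : ∀ x, b x = Real.exp (-(x : ℝ) ^ 2) := fun x => rfl
  -- The algebra generated by exp (-x²) consists of combinations of the exp (-n x²), including n =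
  -- 0. It separates points because squaring is injective on the closed half-line.
  let A : StarSubalgebra ℝ (BoundedContinuousFunction ℝ≥0 ℝ) :=
    { Algebra.adjoin ℝ {b} with
      star_mem' := fun {a} ha => by
        have : star a = a := by ext x; simp
        rw [this]; exact ha }
  have hA : ∀ g, g ∈ A ↔ g ∈ Algebra.adjoin ℝ {b} := fun g => Iff.rfl
  refine ext_of_forall_mem_subalgebra_integral_eq_of_pseudoEMetric_complete_countable
    (𝕜 := ℝ) (A := A) ?_ ?_
  · intro x y hxy
    refine ⟨b, ⟨b, ⟨b, (hA b).2 (Algebra.subset_adjoin rfl), rfl⟩, rfl⟩, ?_⟩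
    rw [hb, hb]
    intro he
    have h2 := Real.exp_injective he
    have h3 : (x : ℝ) = y := by
      have h4 : (x : ℝ) ^ 2 = (y : ℝ) ^ 2 := by linarith
      exact (pow_left_inj₀ x.2 y.2 two_ne_zero).1 h4
    exact hxy (NNReal.coe_injective h3)
  · intro g hg
    rw [hA, Algebra.adjoin_singleton_eq_range_aeval] at hg
    obtain ⟨p, rfl⟩ := hg
    have hint : ∀ (R : Measure ℝ≥0) [IsFiniteMeasure R] (g : BoundedContinuousFunction ℝ≥0 ℝ),
        Integrable (fun x => g x) R := fun R _ g => g.integrable R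
    change ∫ x, (Polynomial.aeval b p) x ∂P = ∫ x, (Polynomial.aeval b p) x ∂Q
    induction p using Polynomial.induction_on' with
    | add p q hp hq =>
      simp only [map_add, BoundedContinuousFunction.coe_add, Pi.add_apply]
      rw [integral_add (hint _ _) (hint _ _), integral_add (hint _ _) (hint _ _), hp, hq]
    | monomial n c =>
      have : ∀ x, (Polynomial.aeval b (Polynomial.monomial n c)) x
          = c * Real.exp (-(n * (x : ℝ) ^ 2)) := by
        intro x
        simp only [Polynomial.aeval_monomial, BoundedContinuousFunction.coe_mul, Pi.mul_apply,
          BoundedContinuousFunction.coe_pow, Pi.pow_apply, hb]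
        rw [← Real.exp_nat_mul, mul_neg]
        rfl
      simp only [this, integral_const_mul, h n]

/-- Finite measures on the half-line `(0, ∞)` are determined by the integrals of the functions
`exp (-n x²)`. -/
lemma Real.measure_ext_of_integral_exp_neg_sq {P Q : Measure ℝ} [IsFiniteMeasure P]
    [IsFiniteMeasure Q] (hP : ∀ᵐ x ∂P, 0 < x) (hQ : ∀ᵐ x ∂Q, 0 < x)
    (h : ∀ n : ℕ, ∫ x, Real.exp (-(n * x ^ 2)) ∂P = ∫ x, Real.exp (-(n * x ^ 2)) ∂Q) :
    P = Q := by
  have hid : ∀ ν : Measure ℝ, (∀ᵐ x ∂ν, 0 < x) →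
      (ν.map Real.toNNReal).map ((↑) : ℝ≥0 → ℝ) = ν := by
    intro ν hν
    rw [Measure.map_map measurable_coe_nnreal_real measurable_real_toNNReal]
    conv_rhs => rw [← Measure.map_id (μ := ν)]
    refine Measure.map_congr ?_
    filter_upwards [hν] with x hx
    simp [hx.le]
  have hint : ∀ ν : Measure ℝ, (∀ᵐ x ∂ν, 0 < x) → ∀ n : ℕ,
      ∫ x : ℝ≥0, Real.exp (-(n * (x : ℝ) ^ 2)) ∂(ν.map Real.toNNReal)
        = ∫ x, Real.exp (-(n * x ^ 2)) ∂ν := by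
    intro ν hν n
    rw [integral_map measurable_real_toNNReal.aemeasurable (by fun_prop)]
    refine integral_congr_ae ?_
    filter_upwards [hν] with x hx
    simp [hx.le]
  rw [← hid P hP, ← hid Q hQ]
  congr 1
  exact NNReal.measure_ext_of_integral_exp_neg_sq fun n => by
    rw [hint P hP, hint Q hQ, h n]

/-- The positive and negative parts of G are densities of finite measures with equal Gaussian
integrals, so these measures coincide. -/
lemma ae_eq_zero_of_integral_exp_neg_sq_real {μ : Measure ℝ} (hμ : ∀ᵐ x ∂μ, 0 < x)
    {G : ℝ → ℝ} (hG : Integrable G μ)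
    (h : ∀ n : ℕ, ∫ x, Real.exp (-(n * x ^ 2)) * G x ∂μ = 0) : G =ᵐ[μ] 0 := by
  have hp : AEMeasurable (fun x => ENNReal.ofReal (G x)) μ := hG.aemeasurable.ennreal_ofReal
  have hn : AEMeasurable (fun x => ENNReal.ofReal (-G x)) μ := hG.aemeasurable.neg.ennreal_ofReal
  have : IsFiniteMeasure (μ.withDensity fun x => ENNReal.ofReal (G x)) :=
    isFiniteMeasure_withDensity_ofReal hG.2
  have : IsFiniteMeasure (μ.withDensity fun x => ENNReal.ofReal (-G x)) :=
    isFiniteMeasure_withDensity_ofReal hG.neg.2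
  have key : (μ.withDensity fun x => ENNReal.ofReal (G x)) =
      μ.withDensity fun x => ENNReal.ofReal (-G x) := by
    refine Real.measure_ext_of_integral_exp_neg_sq
      ((withDensity_absolutelyContinuous _ _).ae_le hμ)
      ((withDensity_absolutelyContinuous _ _).ae_le hμ) fun n => ?_
    rw [integral_withDensity_eq_integral_toReal_smul₀ hp (by simp),
      integral_withDensity_eq_integral_toReal_smul₀ hn (by simp), ← sub_eq_zero]
    have hb : ∀ᵐ x ∂μ, ‖Real.exp (-(n * x ^ 2))‖ ≤ 1 := .of_forall fun x => by
      rw [Real.norm_of_nonneg (Real.exp_nonneg _)]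
      exact Real.exp_le_one_iff.2 (by have : 0 ≤ n * x ^ 2 := by positivity
                                      linarith)
    have hm : AEStronglyMeasurable (fun x : ℝ => Real.exp (-(n * x ^ 2))) μ :=
      Continuous.aestronglyMeasurable (by fun_prop)
    rw [← integral_sub, ← h n]
    · refine integral_congr_ae (.of_forall fun x => ?_)
      simp only [smul_eq_mul, ENNReal.toReal_ofReal',
        ← sub_mul]
      rw [mul_comm]
      congr 1
      rcases le_total (G x) 0 with hx | hx
      · rw [max_eq_right hx, max_eq_left (by linarith)]; ring
      · rw [max_eq_left hx, max_eq_right (by linarith)]; ring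
    · simp only [smul_eq_mul, ENNReal.toReal_ofReal']
      exact hG.pos_part.mul_bdd (c := 1) hm hb
    · simp only [smul_eq_mul, ENNReal.toReal_ofReal']
      exact hG.neg.pos_part.mul_bdd (c := 1) hm hb
  have h2 := (withDensity_eq_iff hp hn hG.lintegral_lt_top.ne).1 key
  filter_upwards [h2] with x hx
  have h3 := congrArg ENNReal.toReal hx
  simp only [ENNReal.toReal_ofReal'] at h3
  rcases le_total (G x) 0 with hx | hx
  · rw [max_eq_right hx, max_eq_left (by linarith)] at h3; simp; linarith
  · rw [max_eq_left hx, max_eq_right (by linarith)] at h3; simpa using h3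

/-- A function on `(0, ∞)` is determined by its Gaussian integrals
`∫ exp (-a x²) F(x) dμ(x)`, `a ≥ c`. -/
lemma ae_eq_zero_of_integral_exp_neg_sq {𝕜 : Type*} [RCLike 𝕜] {μ : Measure ℝ}
    (hμ : ∀ᵐ x ∂μ, 0 < x) {F : ℝ → 𝕜} {c : ℝ}
    (hF : Integrable (fun x => Real.exp (-(c * x ^ 2)) • F x) μ)
    (h : ∀ a, c ≤ a → ∫ x, Real.exp (-(a * x ^ 2)) • F x ∂μ = 0) : F =ᵐ[μ] 0 := by
  -- With exp (-c x²) absorbed into F, the product is integrable and only the exponents a = c + n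
  -- are needed.
  have hn : ∀ n : ℕ, ∫ x, Real.exp (-(n * x ^ 2)) • Real.exp (-(c * x ^ 2)) • F x ∂μ = 0 := by
    intro n
    rw [← h (c + n) (by simp)]
    congr 1 with x
    rw [smul_smul, ← Real.exp_add]
    ring_nf
  have hi : ∀ n : ℕ,
      Integrable (fun x => Real.exp (-(n * x ^ 2)) • Real.exp (-(c * x ^ 2)) • F x) μ := by
    intro n
    refine hF.bdd_smul (φ := fun x => Real.exp (-(n * x ^ 2))) 1 (Continuous.aestronglyMeasurable (by fun_prop))
      (.of_forall fun x => ?_)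
    rw [Real.norm_of_nonneg (Real.exp_nonneg _)]
    exact Real.exp_le_one_iff.2 (by have : 0 ≤ n * x ^ 2 := by positivity
                                    linarith)
  have hre := ae_eq_zero_of_integral_exp_neg_sq_real hμ hF.re fun n => by
    have := congrArg RCLike.re (hn n)
    rw [← integral_re (hi n)] at this
    simpa [RCLike.smul_re] using this
  have him := ae_eq_zero_of_integral_exp_neg_sq_real hμ hF.im fun n => by
    have := congrArg RCLike.im (hn n)
    rw [← integral_im (hi n)] at this
    simpa [RCLike.smul_im] using this
  filter_upwards [hre, him] with x h1 h2
  have h3 : Real.exp (-(c * x ^ 2)) • F x = 0 := RCLike.ext (by simpa using h1) (by simpa using h2)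
  exact (smul_eq_zero.1 h3).resolve_left (Real.exp_ne_zero _)

/-! ### Gaussian moments of μ_α -/

lemma integrable_pow_mul_exp_neg_besselMeasure {α : ℝ} (hα : -1 < α) {a : ℝ} (ha : 0 < a)
    (k : ℕ) :
    Integrable (fun x : ℝ => x ^ (2 * k) * Real.exp (-(a * x ^ 2))) (besselMeasure α) := by
  rw [integrable_besselMeasure_iff]
  refine (integrableOn_rpow_mul_exp_neg_mul_sq ha (s := 2 * α + 1 + 2 * k)
    (by have : (0 : ℝ) ≤ k := k.cast_nonneg
        linarith)).congr_fun (fun x hx => ?_) measurableSet_Ioi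
  have hx' : (0 : ℝ) < x := hx
  simp only [smul_eq_mul]
  rw [Real.rpow_add hx', ← mul_assoc, neg_mul]
  congr 2
  exact_mod_cast Real.rpow_natCast x (2 * k)

lemma integral_pow_mul_exp_neg_besselMeasure {α : ℝ} (hα : -1 < α) {a : ℝ} (ha : 0 < a)
    (k : ℕ) :
    ∫ x : ℝ, x ^ (2 * k) * Real.exp (-(a * x ^ 2)) ∂(besselMeasure α) =
      1 / 2 * a ^ (-α - 1) * (Real.Gamma (k + α + 1) / a ^ k) := by
  rw [integral_besselMeasure]
  have h := integral_rpow_mul_exp_neg_mul_rpow (p := 2) (q := 2 * α + 1 + 2 * k) (b := a) two_pos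
    (by have : (0 : ℝ) ≤ k := k.cast_nonneg
        linarith) ha
  rw [show (2 * α + 1 + 2 * k + 1) / 2 = k + α + 1 by ring,
    show -(2 * α + 1 + 2 * k + 1) / 2 = (-α - 1) - k by ring, Real.rpow_sub_natCast ha.ne'] at h
  rw [show 1 / 2 * a ^ (-α - 1) * (Real.Gamma (k + α + 1) / a ^ k) =
    a ^ (-α - 1) / a ^ k * (1 / 2) * Real.Gamma (k + α + 1) by ring, ← h]
  refine setIntegral_congr_fun measurableSet_Ioi fun x hx => ?_
  have hx' : (0 : ℝ) < x := hx
  have h2 : x ^ (2 * (k : ℝ)) = x ^ (2 * k) := by exact_mod_cast Real.rpow_natCast x (2 * k)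
  simp only [smul_eq_mul]
  rw [Real.rpow_add hx' (2 * α + 1), h2, ← mul_assoc, neg_mul, Real.rpow_two]

/-! ### The Bessel series: growth and Weber's first integral -/

noncomputable section

/-- The entire function `∑ w^k / (k! Γ(k + α + 1))`, which generates the Bessel functions `J_α`
and `I_α`. -/
def besselEntire (α w : ℝ) : ℝ := ∑' k : ℕ, w ^ k / (k.factorial * Real.Gamma (k + α + 1))

lemma natCast_add_add_one_pos {α : ℝ} (hα : -1 < α) (k : ℕ) : 0 < (k : ℝ) + α + 1 := by
  have : (0 : ℝ) ≤ k := k.cast_nonneg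
  linarith

lemma factorial_mul_Gamma_pos {α : ℝ} (hα : -1 < α) (k : ℕ) :
    0 < (k.factorial : ℝ) * Real.Gamma (k + α + 1) :=
  mul_pos (by positivity) (Real.Gamma_pos_of_pos (natCast_add_add_one_pos hα k))

/-- Each step of the Gamma recursion contributes k + (1 + α) ≥ m k + m. The parameter m covers -1 <
α < 0, where Γ(k+α+1) may fall below Γ(α+1) k!. -/
lemma Gamma_mul_pow_mul_factorial_le {α m : ℝ} (hα : -1 < α) (hm0 : 0 ≤ m) (hm1 : m ≤ 1)
    (hm : m ≤ 1 + α) (k : ℕ) :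
    Real.Gamma (α + 1) * m ^ k * k.factorial ≤ Real.Gamma (k + α + 1) := by
  induction k with
  | zero => simp
  | succ k ih =>
    have hk : (0 : ℝ) ≤ k := k.cast_nonneg
    have hp := natCast_add_add_one_pos hα k
    rw [show ((k + 1 : ℕ) : ℝ) + α + 1 = (k + α + 1) + 1 by push_cast; ring,
      Real.Gamma_add_one hp.ne', Nat.factorial_succ, pow_succ]
    push_cast
    have h1 : m * (k + 1) ≤ k + α + 1 := by nlinarith
    calc Real.Gamma (α + 1) * (m ^ k * m) * ((k + 1) * k.factorial)
        = (m * (k + 1)) * (Real.Gamma (α + 1) * m ^ k * k.factorial) := by ring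
      _ ≤ (k + α + 1) * Real.Gamma (k + α + 1) := by
        refine mul_le_mul h1 ih ?_ hp.le
        have := Real.Gamma_pos_of_pos (show 0 < α + 1 by linarith)
        positivity

lemma factorial_two_mul_le (k : ℕ) :
    ((2 * k).factorial : ℝ) ≤ 4 ^ k * (k.factorial * k.factorial) := by
  have h1 : (2 * k).choose k * k.factorial * (2 * k - k).factorial = (2 * k).factorial :=
    Nat.choose_mul_factorial_mul_factorial (by omega)
  have h2 : (2 * k).choose k ≤ 4 ^ k := by
    simpa [pow_mul] using Nat.choose_le_two_pow (2 * k) k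
  rw [show 2 * k - k = k by omega] at h1
  rw [← h1, mul_assoc]
  exact_mod_cast Nat.mul_le_mul_right _ h2

/-- Since (2k)! ≤ 4^k (k!)², the denominator is at least Γ(α+1) (m/4)^k (2k)!. The terms are thus
dominated by those of a cosh series, with M² = 4/m. -/
lemma exists_bound_besselEntire_term {α : ℝ} (hα : -1 < α) :
    ∃ C M : ℝ, 0 < C ∧ 0 < M ∧ ∀ (z w : ℝ) (k : ℕ), |w| ≤ z ^ 2 →
      ‖w ^ k / (k.factorial * Real.Gamma (k + α + 1))‖ ≤
        C * ((M * z) ^ (2 * k) / (2 * k).factorial) := by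
  have hΓ := Real.Gamma_pos_of_pos (show 0 < α + 1 by linarith)
  set m : ℝ := min 1 (1 + α) with hm
  have hm0 : 0 < m := lt_min one_pos (by linarith)
  refine ⟨1 / Real.Gamma (α + 1), √(4 / m), by positivity, by positivity, fun z w k hw => ?_⟩
  have h1 := Gamma_mul_pow_mul_factorial_le hα hm0.le (min_le_left _ _) (min_le_right _ _) k
  have h2 := factorial_two_mul_le k
  have hk : (0 : ℝ) < k.factorial := by positivity
  have h2k : (0 : ℝ) < (2 * k).factorial := by positivity
  rw [norm_div, Real.norm_of_nonneg (factorial_mul_Gamma_pos hα k).le, norm_pow, Real.norm_eq_abs,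
    pow_mul, mul_pow, Real.sq_sqrt (by positivity), mul_pow, ← mul_div_assoc,
    div_le_div_iff₀ (factorial_mul_Gamma_pos hα k) h2k, div_pow]
  have h3 : |w| ^ k ≤ (z ^ 2) ^ k := pow_le_pow_left₀ (abs_nonneg _) hw k
  calc |w| ^ k * (2 * k).factorial
      ≤ (z ^ 2) ^ k * (4 ^ k * (k.factorial * k.factorial)) := by gcongr
    _ = 1 / Real.Gamma (α + 1) * (4 ^ k / m ^ k * (z ^ 2) ^ k) *
        (k.factorial * (Real.Gamma (α + 1) * m ^ k * k.factorial)) := by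
        field_simp
    _ ≤ _ := by gcongr

lemma summable_besselEntire {α : ℝ} (hα : -1 < α) (w : ℝ) :
    Summable fun k : ℕ => w ^ k / (k.factorial * Real.Gamma (k + α + 1)) := by
  obtain ⟨C, M, -, -, h⟩ := exists_bound_besselEntire_term hα
  refine Summable.of_norm_bounded ((Real.hasSum_cosh (M * √|w|)).summable.mul_left C) fun k => ?_
  exact h _ _ k (Real.sq_sqrt (abs_nonneg w)).ge

/-- `besselEntire` has order `1 / 2`; in particular it is dominated by Gaussians. -/
lemma exists_bound_besselEntire {α : ℝ} (hα : -1 < α) {b : ℝ} (hb : 0 < b) :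
    ∃ C A : ℝ, 0 ≤ C ∧ 0 ≤ A ∧ ∀ x y w : ℝ, |w| ≤ (x * y) ^ 2 →
      ‖besselEntire α w‖ ≤ C * (Real.exp (A * x ^ 2) * Real.exp (b * y ^ 2)) := by
  obtain ⟨C, M, hC, hM, h⟩ := exists_bound_besselEntire_term hα
  refine ⟨C, M ^ 2 / (4 * b), hC.le, by positivity, fun x y w hw => ?_⟩
  have h1 := (Real.hasSum_cosh (M * (x * y))).mul_left C
  refine (tsum_of_norm_bounded h1 fun k => h _ _ k hw).trans ?_
  gcongr
  rw [← Real.exp_add]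
  have h2 : ∀ u v : ℝ, u ≤ v → -u ≤ v → Real.cosh u ≤ Real.exp v := fun u v h3 h4 => by
    rw [Real.cosh_eq]
    linarith [Real.exp_le_exp.2 h3, Real.exp_le_exp.2 h4]
  -- The choice A = M²/(4b) makes A x² + b y² ∓ M x y a perfect square over 4b.
  have h3 : M ^ 2 / (4 * b) * x ^ 2 + b * y ^ 2 =
      ((M * x) ^ 2 + (2 * b * y) ^ 2) / (4 * b) := by
    field_simp
    ring
  refine h2 _ _ ?_ ?_ <;> rw [h3, le_div_iff₀ (by positivity)]
  · nlinarith [sq_nonneg (M * x - 2 * b * y)]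
  · nlinarith [sq_nonneg (M * x + 2 * b * y)]

lemma besselEntire_pos {α : ℝ} (hα : -1 < α) {w : ℝ} (hw : 0 ≤ w) : 0 < besselEntire α w := by
  refine (summable_besselEntire hα w).tsum_pos (fun k => ?_) 0 ?_
  · have := factorial_mul_Gamma_pos hα k
    positivity
  · simpa using Real.Gamma_pos_of_pos (show 0 < α + 1 by linarith)

lemma measurable_besselEntire {α : ℝ} (hα : -1 < α) : Measurable (besselEntire α) := by
  refine measurable_of_tendsto_metrizable (f := fun n w => ∑ k ∈ Finset.range n,
    w ^ k / (k.factorial * Real.Gamma (k + α + 1))) (fun n => by fun_prop) ?_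
  exact tendsto_pi_nhds.2 fun w => (summable_besselEntire hα w).hasSum.tendsto_sum_nat

lemma integrable_exp_neg_mul_sq_besselMeasure {α : ℝ} (hα : -1 < α) {a : ℝ} (ha : 0 < a) :
    Integrable (fun x : ℝ => Real.exp (-(a * x ^ 2))) (besselMeasure α) := by
  simpa using integrable_pow_mul_exp_neg_besselMeasure hα ha 0

lemma integral_exp_neg_mul_sq_besselMeasure {α : ℝ} (hα : -1 < α) {a : ℝ} (ha : 0 < a) :
    ∫ x : ℝ, Real.exp (-(a * x ^ 2)) ∂(besselMeasure α) =
      1 / 2 * a ^ (-α - 1) * Real.Gamma (α + 1) := by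
  simpa using integral_pow_mul_exp_neg_besselMeasure hα ha 0

/-- Growth at rate a/2 in x² leaves half of the Gaussian for integrability. -/
lemma integrable_exp_neg_mul_besselEntire {α : ℝ} (hα : -1 < α) {a : ℝ} (ha : 0 < a) (s : ℝ) :
    Integrable (fun x : ℝ => Real.exp (-(a * x ^ 2)) * besselEntire α (s * x ^ 2))
      (besselMeasure α) := by
  obtain ⟨C, A, -, -, h⟩ := exists_bound_besselEntire hα (b := a / 2) (by positivity)
  refine ((integrable_exp_neg_mul_sq_besselMeasure hα (a := a / 2) (by positivity)).const_mul
    (C * Real.exp (A * √|s| ^ 2))).mono'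
    ((by fun_prop : Measurable _).mul ((measurable_besselEntire hα).comp
      (by fun_prop))).aestronglyMeasurable (.of_forall fun x => ?_)
  rw [norm_mul, Real.norm_of_nonneg (Real.exp_nonneg _)]
  have h1 := h √|s| x (s * x ^ 2) (by
    rw [mul_pow, Real.sq_sqrt (abs_nonneg _), abs_mul, abs_of_nonneg (sq_nonneg x)])
  refine (mul_le_mul_of_nonneg_left h1 (Real.exp_nonneg _)).trans_eq ?_
  rw [show -(a / 2 * x ^ 2) = -(a * x ^ 2) + a / 2 * x ^ 2 by ring, Real.exp_add]
  ring

/-- The moment of order 2k contains Γ(k+α+1), which cancels against the k-th coefficient and leaves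
the exponential series in s/a. The same computation at |s| justifies exchanging sum and integral. -/
lemma integral_exp_neg_mul_besselEntire {α : ℝ} (hα : -1 < α) {a : ℝ} (ha : 0 < a) (s : ℝ) :
    ∫ x : ℝ, Real.exp (-(a * x ^ 2)) * besselEntire α (s * x ^ 2) ∂(besselMeasure α) =
      1 / 2 * a ^ (-α - 1) * Real.exp (s / a) := by
  let c : ℝ → ℕ → ℝ := fun s k => s ^ k / (k.factorial * Real.Gamma (k + α + 1))
  have hterm : ∀ s k, c s k * (1 / 2 * a ^ (-α - 1) * (Real.Gamma (k + α + 1) / a ^ k)) =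
      1 / 2 * a ^ (-α - 1) * ((s / a) ^ k / k.factorial) := by
    intro s k
    have := (Real.Gamma_pos_of_pos (natCast_add_add_one_pos hα k)).ne'
    simp only [c, div_pow]
    field_simp
  have hexp : ∀ s, HasSum (fun k : ℕ => 1 / 2 * a ^ (-α - 1) * ((s / a) ^ k / k.factorial))
      (1 / 2 * a ^ (-α - 1) * Real.exp (s / a)) := by
    intro s
    rw [Real.exp_eq_exp_ℝ]
    exact (NormedSpace.expSeries_div_hasSum_exp (s / a)).mul_left _
  have hint := integrable_pow_mul_exp_neg_besselMeasure hα ha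
  have hsum : Summable fun k : ℕ =>
      ∫ x, ‖c s k * (x ^ (2 * k) * Real.exp (-(a * x ^ 2)))‖ ∂(besselMeasure α) := by
    refine (hexp |s|).summable.congr fun k => ?_
    rw [← hterm, ← integral_pow_mul_exp_neg_besselMeasure hα ha, ← integral_const_mul]
    refine integral_congr_ae (.of_forall fun x => ?_)
    have h0 : 0 ≤ x ^ (2 * k) := (even_two_mul k).pow_nonneg x
    simp only [c]
    rw [norm_mul, norm_div, norm_pow, Real.norm_of_nonneg (factorial_mul_Gamma_pos hα k).le,
      Real.norm_of_nonneg (mul_nonneg h0 (Real.exp_nonneg _)), Real.norm_eq_abs]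
  have hS := hasSum_integral_of_summable_integral_norm
    (fun k => (hint k).const_mul (c s k)) hsum
  simp only [integral_const_mul, integral_pow_mul_exp_neg_besselMeasure hα ha, hterm] at hS
  rw [← hS.unique (hexp s)]
  refine integral_congr_ae (.of_forall fun x => ?_)
  simp only [besselEntire]
  rw [mul_comm, ← tsum_mul_right]
  refine tsum_congr fun k => ?_
  simp only [c, mul_pow, ← pow_mul]
  ring

lemma besselPsi_eq {α x l : ℝ} (hx : 0 < x) (hl : 0 < l) :
    besselPsi α l x = 2 ^ (-α) * besselEntire α (-(x * l) ^ 2 / 4) := by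
  have hxl : 0 < x * l := mul_pos hx hl
  rw [besselPsi, besselJ, ← mul_assoc, Real.div_rpow hxl.le two_pos.le, ← mul_div_assoc,
    ← Real.rpow_add hxl, neg_add_cancel, Real.rpow_zero, one_div, ← Real.rpow_neg two_pos.le]
  congr 1
  refine tsum_congr fun k => ?_
  rw [show -(x * l) ^ 2 / 4 = (-1) * (x * l / 2) ^ 2 by ring, mul_pow, ← pow_mul]
  ring

/-- Gaussian bound for the kernel of the Hankel transform. -/
lemma exists_bound_besselPsi {α : ℝ} (hα : -1 < α) {b : ℝ} (hb : 0 < b) :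
    ∃ C A : ℝ, 0 ≤ C ∧ 0 ≤ A ∧ ∀ x l : ℝ, 0 < x → 0 < l →
      ‖besselPsi α l x‖ ≤ C * (Real.exp (A * x ^ 2) * Real.exp (b * l ^ 2)) := by
  obtain ⟨C, A, hC, hA, h⟩ := exists_bound_besselEntire hα hb
  refine ⟨2 ^ (-α) * C, A, by positivity, hA, fun x l hx hl => ?_⟩
  rw [besselPsi_eq hx hl, norm_mul, Real.norm_of_nonneg (by positivity), mul_assoc]
  refine mul_le_mul_of_nonneg_left (h x l _ ?_) (by positivity)
  rw [neg_div, abs_neg, abs_of_nonneg (by positivity)]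
  have : 0 ≤ (x * l) ^ 2 := by positivity
  linarith

lemma besselPsi_comm (α l x : ℝ) : besselPsi α l x = besselPsi α x l := by
  simp only [besselPsi, mul_comm]

/-- Weber's first exponential integral: the Hankel transform of a Gaussian. -/
lemma integral_exp_neg_mul_besselPsi {α : ℝ} (hα : -1 < α) {a : ℝ} (ha : 0 < a) {x : ℝ}
    (hx : 0 < x) :
    ∫ l, Real.exp (-(a * l ^ 2)) * besselPsi α l x ∂(besselMeasure α) =
      (2 * a) ^ (-α - 1) * Real.exp (-(1 / (4 * a) * x ^ 2)) := by
  have h : ∫ l, Real.exp (-(a * l ^ 2)) * besselPsi α l x ∂(besselMeasure α) =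
      ∫ l, 2 ^ (-α) * (Real.exp (-(a * l ^ 2)) * besselEntire α ((-x ^ 2 / 4) * l ^ 2))
        ∂(besselMeasure α) := by
    refine integral_congr_ae ?_
    filter_upwards [ae_besselMeasure_pos α] with l hl
    rw [besselPsi_eq hx hl, show -(x * l) ^ 2 / 4 = (-x ^ 2 / 4) * l ^ 2 by ring]
    ring
  rw [h, integral_const_mul, integral_exp_neg_mul_besselEntire hα ha,
    Real.mul_rpow two_pos.le ha.le, Real.rpow_sub_one two_ne_zero (-α),
    show -x ^ 2 / 4 / a = -(1 / (4 * a) * x ^ 2) by field_simp]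
  ring

/-! ### Symmetric Markov kernels -/

section MarkovKernel

variable {X : Type*} [MeasurableSpace X] {𝕜 : Type*} [RCLike 𝕜] {μ : Measure X}

/-- Cut at height 1: for finite p, the set where the function is large has finite measure by
Chebyshev, so L^p embeds in L¹ there. -/
lemma MeasureTheory.MemLp.memL1AddLinf {p : ℝ≥0∞} (hp : 1 ≤ p) {f : X → 𝕜} (hf : MemLp f p μ) :
    MemL1AddLinf μ f := by
  rcases eq_or_ne p ∞ with rfl | hp'
  · exact ⟨0, f, MemLp.zero, hf, by simp⟩
  have hm := hf.1.stronglyMeasurable_mk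
  have hg : MemLp (hf.1.mk f) p μ := hf.ae_eq hf.1.ae_eq_mk
  set g := hf.1.mk f with hgdef
  have hs : MeasurableSet {x | 1 ≤ ‖g x‖} := measurableSet_le measurable_const hm.norm.measurable
  refine ⟨{x | 1 ≤ ‖g x‖}.indicator g, {x | 1 ≤ ‖g x‖}ᶜ.indicator g, ?_, ?_, ?_⟩
  · refine (hg.indicator hs).mono_exponent_of_measure_support_ne_top (s := {x | 1 ≤ ‖g x‖})
      (fun x hx => indicator_of_notMem hx _) ?_ hp
    have := hg.meas_ge_lt_top (ε := 1) (zero_lt_one.trans_le hp).ne' hp' one_ne_zero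
    refine ne_of_lt (lt_of_le_of_lt (measure_mono fun x hx => ?_) this)
    have hx' : 1 ≤ ‖g x‖ := hx
    exact_mod_cast hx'
  · refine memLp_top_of_bound (hm.aestronglyMeasurable.indicator hs.compl) 1 (.of_forall fun x => ?_)
    by_cases hx : 1 ≤ ‖g x‖
    · rw [indicator_of_notMem (by simpa using hx)]; simp
    · rw [indicator_of_mem (by simpa using hx)]; exact (not_le.1 hx).le
  · rw [indicator_self_add_compl]
    exact hf.1.ae_eq_mk

lemma MemL1AddLinf.aestronglyMeasurable {f : X → 𝕜} (hf : MemL1AddLinf μ f) :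
    AEStronglyMeasurable f μ := by
  obtain ⟨g, h, hg, hh, hfe⟩ := hf
  exact (hg.1.add hh.1).congr hfe.symm

/-- Symmetric Markov kernels with bounded sections, as densities with respect to `μ`. -/
structure IsSymmMarkovKernel (μ : Measure X) (k : X → X → ℝ) : Prop where
  measurable : Measurable (Function.uncurry k)
  nonneg : ∀ x y, 0 ≤ k x y
  symm : ∀ x y, k x y = k y x
  bounded : ∀ x, ∃ C, ∀ y, k x y ≤ C
  integrable : ∀ x, Integrable (k x) μ
  integral_eq_one : ∀ x, ∫ y, k x y ∂μ = 1

/-- The integral operator with kernel `k`. -/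
def kernelOp (μ : Measure X) (k : X → X → ℝ) (f : X → 𝕜) (x : X) : 𝕜 := ∫ y, k x y • f y ∂μ

namespace IsSymmMarkovKernel

variable {k : X → X → ℝ}

lemma measurable_right (hk : IsSymmMarkovKernel μ k) (x : X) : Measurable (k x) :=
  hk.measurable.comp measurable_prodMk_left

lemma measurable_enorm (hk : IsSymmMarkovKernel μ k) :
    Measurable fun z : X × X => ‖k z.1 z.2‖ₑ := hk.measurable.enorm

lemma lintegral_eq_one (hk : IsSymmMarkovKernel μ k) (x : X) : ∫⁻ y, ‖k x y‖ₑ ∂μ = 1 := by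
  have h := ofReal_integral_norm_eq_lintegral_enorm (hk.integrable x)
  simp_rw [Real.norm_of_nonneg (hk.nonneg _ _), hk.integral_eq_one x] at h
  simpa using h.symm

lemma integrable_smul (hk : IsSymmMarkovKernel μ k) {f : X → 𝕜} (hf : MemL1AddLinf μ f) (x : X) :
    Integrable (fun y => k x y • f y) μ := by
  obtain ⟨g, h, hg, hh, hfe⟩ := hf
  obtain ⟨C, hC⟩ := hk.bounded x
  have h1 : Integrable (k x • g) μ :=
    (memLp_one_iff_integrable.1 hg).bdd_smul C (hk.measurable_right x).aestronglyMeasurable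
      (.of_forall fun y => by rw [Real.norm_of_nonneg (hk.nonneg x y)]; exact hC y)
  have h2 : Integrable (k x • h) μ := (hk.integrable x).smul_of_top_left hh
  refine (h1.add h2).congr ?_
  filter_upwards [hfe] with y hy
  simp [hy, smul_add]

/-- Tonelli; by symmetry the columns of the kernel also have mass one. -/
lemma lintegral_lintegral_mul (hk : IsSymmMarkovKernel μ k) [SFinite μ] {g : X → ℝ≥0∞}
    (hg : AEMeasurable g μ) : ∫⁻ x, ∫⁻ y, ‖k x y‖ₑ * g y ∂μ ∂μ = ∫⁻ y, g y ∂μ := by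
  rw [lintegral_lintegral_swap]
  · refine lintegral_congr fun y => ?_
    simp_rw [hk.symm _ y]
    rw [lintegral_mul_const _ (hk.measurable_right y).enorm, hk.lintegral_eq_one, one_mul]
  · exact hk.measurable_enorm.aemeasurable.mul hg.comp_snd

lemma aestronglyMeasurable_kernelOp (hk : IsSymmMarkovKernel μ k) [SFinite μ] {f : X → 𝕜}
    (hf : AEStronglyMeasurable f μ) : AEStronglyMeasurable (kernelOp μ k f) μ := by
  have : AEStronglyMeasurable (fun z : X × X => k z.1 z.2 • f z.2) (μ.prod μ) :=
    hk.measurable.aestronglyMeasurable.smul hf.comp_snd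
  exact this.integral_prod_right'

/-- This is Jensen's inequality: each row is a probability density, and L^p norms on a probability
space increase with p. -/
lemma enorm_kernelOp_le (hk : IsSymmMarkovKernel μ k) {f : X → 𝕜}
    (hf : AEStronglyMeasurable f μ) {p : ℝ≥0∞} (hp : 1 ≤ p) (x : X) :
    ‖kernelOp μ k f x‖ₑ ≤ eLpNorm f p (μ.withDensity fun y => ‖k x y‖ₑ) := by
  have hprob : IsProbabilityMeasure (μ.withDensity fun y => ‖k x y‖ₑ) :=
    ⟨by rw [withDensity_apply _ .univ, setLIntegral_univ, hk.lintegral_eq_one]⟩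
  refine le_trans ?_ (eLpNorm_le_eLpNorm_of_exponent_le hp
    (hf.mono_ac (withDensity_absolutelyContinuous _ _)))
  rw [eLpNorm_one_eq_lintegral_enorm,
    lintegral_withDensity_eq_lintegral_mul₀ (hk.measurable_right x).enorm.aemeasurable hf.enorm]
  refine (enorm_integral_le_lintegral_enorm _).trans_eq (lintegral_congr fun y => ?_)
  rw [enorm_smul, Pi.mul_apply]

lemma eLpNorm_kernelOp_le (hk : IsSymmMarkovKernel μ k) [SFinite μ] {f : X → 𝕜}
    (hf : AEStronglyMeasurable f μ) {p : ℝ≥0∞} (hp : 1 ≤ p) :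
    eLpNorm (kernelOp μ k f) p μ ≤ eLpNorm f p μ := by
  have hp0 : p ≠ 0 := (zero_lt_one.trans_le hp).ne'
  rcases eq_or_ne p ∞ with rfl | hp'
  · rw [eLpNorm_exponent_top, eLpNorm_exponent_top]
    refine essSup_le_of_ae_le _ (.of_forall fun x => ?_)
    refine (hk.enorm_kernelOp_le hf le_top x).trans ?_
    rw [eLpNorm_exponent_top]
    exact essSup_mono_measure (withDensity_absolutelyContinuous _ _)
  · have hpos := ENNReal.toReal_pos hp0 hp'
    rw [eLpNorm_eq_lintegral_rpow_enorm_toReal hp0 hp', eLpNorm_eq_lintegral_rpow_enorm_toReal hp0 hp']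
    refine ENNReal.rpow_le_rpow ?_ (by positivity)
    have hfp : AEMeasurable (fun y => ‖f y‖ₑ ^ p.toReal) μ := hf.enorm.pow_const _
    rw [← hk.lintegral_lintegral_mul hfp]
    refine lintegral_mono fun x => ?_
    have h := hk.enorm_kernelOp_le hf hp x
    rw [eLpNorm_eq_lintegral_rpow_enorm_toReal hp0 hp', one_div,
      ENNReal.le_rpow_inv_iff hpos,
      lintegral_withDensity_eq_lintegral_mul₀ (hk.measurable_right x).enorm.aemeasurable hfp] at h
    exact h

lemma memLp_kernelOp (hk : IsSymmMarkovKernel μ k) [SFinite μ] {f : X → 𝕜} {p : ℝ≥0∞}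
    (hp : 1 ≤ p) (hf : MemLp f p μ) : MemLp (kernelOp μ k f) p μ :=
  ⟨hk.aestronglyMeasurable_kernelOp hf.1, (hk.eLpNorm_kernelOp_le hf.1 hp).trans_lt hf.2⟩

/-- Together with |f g| ≤ |f|² + |g|², this supplies the Fubini hypothesis for self-adjointness. -/
lemma integrable_prod_mul_sq (hk : IsSymmMarkovKernel μ k) [SFinite μ] {f : X → 𝕜}
    (hf : MemLp f 2 μ) : Integrable (fun z : X × X => k z.1 z.2 * ‖f z.2‖ ^ 2) (μ.prod μ) := by
  have hf2 : Integrable (fun y => ‖f y‖ ^ 2) μ := hf.integrable_norm_pow two_ne_zero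
  have hm : AEStronglyMeasurable (fun z : X × X => k z.1 z.2 * ‖f z.2‖ ^ 2) (μ.prod μ) :=
    hk.measurable.aestronglyMeasurable.mul hf2.1.comp_snd
  refine ⟨hm, ?_⟩
  rw [HasFiniteIntegral, lintegral_prod _ hm.enorm]
  simp_rw [enorm_mul]
  rw [hk.lintegral_lintegral_mul hf2.1.enorm]
  exact hf2.2

/-- Integral operators with symmetric Markov kernels are self-adjoint on `L²`. -/
lemma integral_inner_kernelOp (hk : IsSymmMarkovKernel μ k) [SFinite μ] {f g : X → 𝕜}
    (hf : MemLp f 2 μ) (hg : MemLp g 2 μ) :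
    ∫ x, inner 𝕜 (kernelOp μ k f x) (g x) ∂μ = ∫ x, inner 𝕜 (f x) (kernelOp μ k g x) ∂μ := by
  have hint : Integrable (fun z : X × X => k z.1 z.2 • inner 𝕜 (f z.2) (g z.1)) (μ.prod μ) := by
    have h1 := hk.integrable_prod_mul_sq hf
    have h2 := (hk.integrable_prod_mul_sq hg).swap
    refine (h1.add h2).mono' (hk.measurable.aestronglyMeasurable.smul
      (hf.1.comp_snd.inner hg.1.comp_fst)) (.of_forall fun z => ?_)
    simp only [Pi.add_apply, Function.comp_apply, Prod.fst_swap, Prod.snd_swap]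
    rw [norm_smul, Real.norm_of_nonneg (hk.nonneg _ _), hk.symm z.2 z.1, ← mul_add]
    refine mul_le_mul_of_nonneg_left ((norm_inner_le_norm _ _).trans ?_) (hk.nonneg _ _)
    nlinarith [sq_nonneg (‖f z.2‖ - ‖g z.1‖), sq_nonneg (‖f z.2‖), sq_nonneg (‖g z.1‖)]
  have hL : ∀ x, inner 𝕜 (kernelOp μ k f x) (g x) = ∫ y, k x y • inner 𝕜 (f y) (g x) ∂μ := by
    intro x
    rw [← inner_conj_symm, kernelOp, ← integral_inner
      (hk.integrable_smul (hf.memL1AddLinf one_le_two) x), ← integral_conj]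
    congr 1 with y
    rw [inner_conj_symm, inner_smul_left_eq_smul]
  have hR : ∀ y, inner 𝕜 (f y) (kernelOp μ k g y) = ∫ x, k x y • inner 𝕜 (f y) (g x) ∂μ := by
    intro y
    rw [kernelOp, ← integral_inner (hk.integrable_smul (hg.memL1AddLinf one_le_two) y)]
    congr 1 with x
    rw [inner_smul_right_eq_smul, hk.symm]
  simp_rw [hL, hR]
  exact integral_integral_swap hint

lemma kernelOp_nonneg (hk : IsSymmMarkovKernel μ k) {f : X → 𝕜} (hf : MemL1AddLinf μ f)
    (h0 : 0 ≤ᵐ[μ] f) (x : X) : 0 ≤ kernelOp μ k f x := by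
  have hi := hk.integrable_smul hf x
  rw [RCLike.nonneg_iff, kernelOp, ← integral_re hi, ← integral_im hi]
  constructor
  · refine integral_nonneg_of_ae ?_
    filter_upwards [h0] with y hy
    rw [RCLike.smul_re]
    exact mul_nonneg (hk.nonneg x y) (RCLike.nonneg_iff.1 hy).1
  · refine integral_eq_zero_of_ae ?_
    filter_upwards [h0] with y hy
    rw [RCLike.smul_im, (RCLike.nonneg_iff.1 hy).2, mul_zero, Pi.zero_apply]

lemma kernelOp_one (hk : IsSymmMarkovKernel μ k) (x : X) :
    kernelOp μ k (fun _ => (1 : 𝕜)) x = 1 := by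
  rw [kernelOp, integral_smul_const, hk.integral_eq_one, one_smul]

lemma kernelOp_add (hk : IsSymmMarkovKernel μ k) {f g : X → 𝕜} (hf : MemL1AddLinf μ f)
    (hg : MemL1AddLinf μ g) : kernelOp μ k (f + g) = kernelOp μ k f + kernelOp μ k g := by
  ext x
  simp only [kernelOp, Pi.add_apply, smul_add]
  exact integral_add (hk.integrable_smul hf x) (hk.integrable_smul hg x)

lemma integrable_prod_mul [SFinite μ] {k₁ k₂ : X → X → ℝ} (h₁ : IsSymmMarkovKernel μ k₁)
    (h₂ : IsSymmMarkovKernel μ k₂) (x : X) :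
    Integrable (fun w : X × X => k₁ x w.1 * k₂ w.1 w.2) (μ.prod μ) := by
  have hm : AEStronglyMeasurable (fun w : X × X => k₁ x w.1 * k₂ w.1 w.2) (μ.prod μ) :=
    (((h₁.measurable_right x).comp measurable_fst).mul h₂.measurable).aestronglyMeasurable
  refine (integrable_prod_iff hm).2 ⟨.of_forall fun z => (h₂.integrable z).const_mul (k₁ x z), ?_⟩
  refine (h₁.integrable x).congr (.of_forall fun z => ?_)
  simp only [Real.norm_of_nonneg (mul_nonneg (h₁.nonneg _ _) (h₂.nonneg _ _))]
  rw [integral_const_mul, h₂.integral_eq_one, mul_one]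

/-- The composition of two kernel operators, given the Chapman–Kolmogorov identity. -/
lemma kernelOp_kernelOp [SFinite μ] {k₁ k₂ k₃ : X → X → ℝ} (h₁ : IsSymmMarkovKernel μ k₁)
    (h₂ : IsSymmMarkovKernel μ k₂) (h₃ : IsSymmMarkovKernel μ k₃) {x : X}
    (h : ∀ᵐ y ∂μ, ∫ z, k₁ x z * k₂ z y ∂μ = k₃ x y) {f : X → 𝕜} (hf : MemL1AddLinf μ f) :
    kernelOp μ k₁ (kernelOp μ k₂ f) x = kernelOp μ k₃ f x := by
  have hi : ∀ y, Integrable (fun z => k₁ x z * k₂ z y) μ := fun y => by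
    obtain ⟨C, hC⟩ := h₂.bounded y
    simp_rw [h₂.symm _ y]
    exact (h₁.integrable x).mul_bdd (c := C) (h₂.measurable_right y).aestronglyMeasurable
      (.of_forall fun z => by rw [Real.norm_of_nonneg (h₂.nonneg y z)]; exact hC z)
  have hm : AEStronglyMeasurable (fun w : X × X => (k₁ x w.1 * k₂ w.1 w.2) • f w.2) (μ.prod μ) :=
    (((h₁.measurable_right x).comp measurable_fst).mul h₂.measurable).aestronglyMeasurable.smul
      hf.aestronglyMeasurable.comp_snd
  have hint : Integrable (fun w : X × X => (k₁ x w.1 * k₂ w.1 w.2) • f w.2) (μ.prod μ) := by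
    -- Absolute integrability also comes from Chapman–Kolmogorov: integrating the norm in z gives k₃
    -- x y ‖f y‖.
    refine (integrable_prod_iff' hm).2 ⟨.of_forall fun y => (hi y).smul_const (f y), ?_⟩
    refine (h₃.integrable_smul hf x).norm.congr ?_
    filter_upwards [h] with y hy
    simp only [norm_smul, Real.norm_of_nonneg (mul_nonneg (h₁.nonneg _ _) (h₂.nonneg _ _)),
      Real.norm_of_nonneg (h₃.nonneg _ _)]
    rw [integral_mul_const, hy]
  calc kernelOp μ k₁ (kernelOp μ k₂ f) x
      = ∫ z, ∫ y, (k₁ x z * k₂ z y) • f y ∂μ ∂μ := by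
        simp only [kernelOp, ← integral_smul, smul_smul]
    _ = ∫ y, ∫ z, (k₁ x z * k₂ z y) • f y ∂μ ∂μ := integral_integral_swap hint
    _ = kernelOp μ k₃ f x := by
        refine integral_congr_ae ?_
        filter_upwards [h] with y hy
        rw [integral_smul_const, hy]

end IsSymmMarkovKernel

end MarkovKernel

/-! ### The explicit heat kernel -/

/-- The heat kernel `(2t)⁻¹ (x y)^{-α} exp (-(x² + y²) / (4t)) I_α(x y / (2t))`, with `I_α`
expanded into its power series. -/
def besselHeatKernel (α t x y : ℝ) : ℝ :=
  2 * (4 * t) ^ (-α - 1) * (Real.exp (-(x ^ 2 / (4 * t))) * Real.exp (-(y ^ 2 / (4 * t)))) *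
    besselEntire α ((x * y) ^ 2 / (16 * t ^ 2))

lemma exp_neg_mul_besselHeatKernel (α t a x y : ℝ) :
    Real.exp (-(a * y ^ 2)) * besselHeatKernel α t x y =
      2 * (4 * t) ^ (-α - 1) * Real.exp (-(x ^ 2 / (4 * t))) *
        (Real.exp (-((a + 1 / (4 * t)) * y ^ 2)) *
          besselEntire α (x ^ 2 / (16 * t ^ 2) * y ^ 2)) := by
  rw [besselHeatKernel, show (x * y) ^ 2 / (16 * t ^ 2) = x ^ 2 / (16 * t ^ 2) * y ^ 2 by ring,
    show -((a + 1 / (4 * t)) * y ^ 2) = -(a * y ^ 2) + -(y ^ 2 / (4 * t)) by ring, Real.exp_add]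
  ring

lemma integrable_exp_neg_mul_besselHeatKernel {α : ℝ} (hα : -1 < α) {t : ℝ} (ht : 0 < t)
    {a : ℝ} (ha : 0 ≤ a) (x : ℝ) :
    Integrable (fun y => Real.exp (-(a * y ^ 2)) * besselHeatKernel α t x y)
      (besselMeasure α) := by
  simp_rw [exp_neg_mul_besselHeatKernel]
  exact (integrable_exp_neg_mul_besselEntire hα (by positivity) _).const_mul _

/-- The heat evolution of a Gaussian. -/
lemma integral_exp_neg_mul_besselHeatKernel {α : ℝ} (hα : -1 < α) {t : ℝ} (ht : 0 < t)
    {a : ℝ} (ha : 0 ≤ a) (x : ℝ) :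
    ∫ y, Real.exp (-(a * y ^ 2)) * besselHeatKernel α t x y ∂(besselMeasure α) =
      (1 + 4 * a * t) ^ (-α - 1) * Real.exp (-(a / (1 + 4 * a * t) * x ^ 2)) := by
  simp_rw [exp_neg_mul_besselHeatKernel]
  have h0 : 0 < 1 + 4 * a * t := by positivity
  rw [integral_const_mul, integral_exp_neg_mul_besselEntire hα (by positivity),
    show a + 1 / (4 * t) = (1 + 4 * a * t) / (4 * t) by field_simp; ring,
    Real.div_rpow h0.le (by positivity),
    -- The second summand is the exponent s/a of `integral_exp_neg_mul_besselEntire`, for s =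
    -- x²/(16t²) and the Gaussian parameter a + 1/(4t).
    show -(a / (1 + 4 * a * t) * x ^ 2) = -(x ^ 2 / (4 * t)) +
      x ^ 2 / (16 * t ^ 2) / ((1 + 4 * a * t) / (4 * t)) by field_simp; ring, Real.exp_add]
  have : (4 * t) ^ (-α - 1) ≠ 0 := (Real.rpow_pos_of_pos (by positivity) _).ne'
  field_simp

lemma isSymmMarkovKernel_besselHeatKernel {α : ℝ} (hα : -1 < α) {t : ℝ} (ht : 0 < t) :
    IsSymmMarkovKernel (besselMeasure α) (besselHeatKernel α t) where
  measurable := by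
    unfold besselHeatKernel Function.uncurry
    exact Measurable.mul (by fun_prop) ((measurable_besselEntire hα).comp (by fun_prop))
  nonneg x y := by
    have := (besselEntire_pos hα (w := (x * y) ^ 2 / (16 * t ^ 2)) (by positivity)).le
    unfold besselHeatKernel
    positivity
  symm x y := by
    rw [besselHeatKernel, besselHeatKernel, mul_comm x y,
      mul_comm (Real.exp (-(x ^ 2 / (4 * t))))]
  bounded x := by
    -- The rate 1/(4t) is exactly cancelled by the Gaussian factor in y, leaving a bound that
    -- depends on x only.
    obtain ⟨C, A, hC, -, h⟩ := exists_bound_besselEntire hα (b := 1 / (4 * t)) (by positivity)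
    refine ⟨2 * (4 * t) ^ (-α - 1) * Real.exp (-(x ^ 2 / (4 * t))) *
      (C * Real.exp (A * (x / (4 * t)) ^ 2)), fun y => ?_⟩
    have h1 := (Real.le_norm_self _).trans (h (x / (4 * t)) y ((x * y) ^ 2 / (16 * t ^ 2)) (by
      rw [abs_of_nonneg (by positivity)]
      exact le_of_eq (by field_simp; ring)))
    refine (mul_le_mul_of_nonneg_left h1 (by positivity)).trans_eq ?_
    have h2 : Real.exp (-(y ^ 2 / (4 * t))) * Real.exp (1 / (4 * t) * y ^ 2) = 1 := by
      rw [← Real.exp_add, Real.exp_eq_one_iff]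
      ring
    linear_combination (2 * (4 * t) ^ (-α - 1) * Real.exp (-(x ^ 2 / (4 * t))) *
      (C * Real.exp (A * (x / (4 * t)) ^ 2))) * h2
  integrable x := by
    simpa using integrable_exp_neg_mul_besselHeatKernel hα ht le_rfl x
  integral_eq_one x := by
    simpa using integral_exp_neg_mul_besselHeatKernel hα ht le_rfl x

/-- The Chapman–Kolmogorov identity for the Bessel heat kernel. -/
lemma integral_besselHeatKernel_mul {α : ℝ} (hα : -1 < α) {s t : ℝ} (hs : 0 < s) (ht : 0 < t)
    (x : ℝ) : ∀ᵐ y ∂(besselMeasure α),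
      ∫ z, besselHeatKernel α s x z * besselHeatKernel α t z y ∂(besselMeasure α) =
        besselHeatKernel α (s + t) x y := by
  have h₁ := isSymmMarkovKernel_besselHeatKernel hα hs
  have h₂ := isSymmMarkovKernel_besselHeatKernel hα ht
  have hint := h₁.integrable_prod_mul h₂ x
  have hint2 : ∀ a : ℝ, 0 ≤ a → Integrable (fun w : ℝ × ℝ => Real.exp (-(a * w.2 ^ 2)) *
      (besselHeatKernel α s x w.1 * besselHeatKernel α t w.1 w.2))
      ((besselMeasure α).prod (besselMeasure α)) := fun a ha =>
    Integrable.bdd_smul (φ := fun w : ℝ × ℝ => Real.exp (-(a * w.2 ^ 2))) hint 1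
      (Measurable.aestronglyMeasurable (by fun_prop)) (.of_forall fun w => by
      rw [Real.norm_of_nonneg (Real.exp_nonneg _)]
      exact Real.exp_le_one_iff.2 (neg_nonpos.2 (by positivity)))
  have hL : ∀ a : ℝ, 0 ≤ a → Integrable (fun y => Real.exp (-(a * y ^ 2)) *
      ∫ z, besselHeatKernel α s x z * besselHeatKernel α t z y ∂(besselMeasure α))
      (besselMeasure α) := fun a ha => by
    simp_rw [← integral_const_mul]
    exact (hint2 a ha).integral_prod_right
  have hR := fun a ha => integrable_exp_neg_mul_besselHeatKernel hα (add_pos hs ht) (a := a) ha x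
  have key := ae_eq_zero_of_integral_exp_neg_sq (𝕜 := ℝ) (ae_besselMeasure_pos α) (c := 0)
    (F := fun y => ∫ z, besselHeatKernel α s x z * besselHeatKernel α t z y ∂(besselMeasure α) -
      besselHeatKernel α (s + t) x y)
    (by simp_rw [smul_eq_mul, mul_sub]; exact (hL 0 le_rfl).sub (hR 0 le_rfl))
    (fun a ha => by
      simp_rw [smul_eq_mul, mul_sub]
      rw [integral_sub (hL a ha) (hR a ha),
        integral_exp_neg_mul_besselHeatKernel hα (add_pos hs ht) ha, sub_eq_zero]
      simp_rw [← integral_const_mul]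
      rw [← integral_integral_swap (f := fun z y => Real.exp (-(a * y ^ 2)) *
        (besselHeatKernel α s x z * besselHeatKernel α t z y)) (hint2 a ha)]
      -- The Gaussian evolves for time t, then for time s. The prefactors compose because
      -- (1+4at)(1+4as/(1+4at)) = 1+4a(s+t).
      have h4 : ∀ z, ∫ y, Real.exp (-(a * y ^ 2)) *
          (besselHeatKernel α s x z * besselHeatKernel α t z y) ∂(besselMeasure α) =
          (1 + 4 * a * t) ^ (-α - 1) *
            (Real.exp (-(a / (1 + 4 * a * t) * z ^ 2)) * besselHeatKernel α s x z) := by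
        intro z
        simp_rw [mul_left_comm _ (besselHeatKernel α s x z)]
        rw [integral_const_mul, integral_exp_neg_mul_besselHeatKernel hα ht ha]
        ring
      simp_rw [h4]
      rw [integral_const_mul, integral_exp_neg_mul_besselHeatKernel hα hs (by positivity),
        ← mul_assoc, ← Real.mul_rpow (by positivity) (by positivity)]
      congr 3
      · field_simp
        ring
      · field_simp
        ring)
  filter_upwards [key] with y hy
  exact sub_eq_zero.1 hy

/-! ### Weber's second integral -/

lemma besselJ_eq (α z : ℝ) : besselJ α z = (z / 2) ^ α * besselEntire α (-(z / 2) ^ 2) := by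
  rw [besselJ, besselEntire]
  congr 1
  refine tsum_congr fun k => ?_
  rw [neg_pow ((z / 2) ^ 2), ← pow_mul]
  ring

lemma measurable_besselPsi {α : ℝ} (hα : -1 < α) :
    Measurable fun z : ℝ × ℝ => besselPsi α z.1 z.2 := by
  have hE := measurable_besselEntire hα
  simp only [besselPsi, besselJ_eq]
  fun_prop

/-- Integration of a pointwise Hankel transform against Gaussians. -/
lemma exists_integral_exp_neg_mul_integral_besselPsi {𝕜 : Type*} [RCLike 𝕜] {α : ℝ} (hα : -1 < α)
    {b : ℝ} (hb : 0 < b) {g : ℝ → 𝕜} (hgm : AEStronglyMeasurable g (besselMeasure α))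
    (hg : Integrable (fun x => Real.exp (b * x ^ 2) * ‖g x‖) (besselMeasure α)) :
    ∃ c : ℝ, 0 < c ∧ ∀ a, c ≤ a →
      Integrable (fun l => Real.exp (-(a * l ^ 2)) • ∫ x, besselPsi α l x • g x ∂(besselMeasure α))
        (besselMeasure α) ∧
      ∫ l, Real.exp (-(a * l ^ 2)) • ∫ x, besselPsi α l x • g x ∂(besselMeasure α)
        ∂(besselMeasure α) =
      ∫ x, ((2 * a) ^ (-α - 1) * Real.exp (-(1 / (4 * a) * x ^ 2))) • g x ∂(besselMeasure α) := by
  -- The kernel is symmetric, so the prescribed rate b can be put on x, where g absorbs it. The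
  -- uncontrolled rate A falls on l, hence the threshold A + 1.
  obtain ⟨C, A, hC, hA, h⟩ := exists_bound_besselPsi hα hb
  refine ⟨A + 1, by positivity, fun a ha => ?_⟩
  have hint : Integrable (fun z : ℝ × ℝ => Real.exp (-(a * z.1 ^ 2)) • besselPsi α z.1 z.2 • g z.2)
      ((besselMeasure α).prod (besselMeasure α)) := by
    refine (((integrable_exp_neg_mul_sq_besselMeasure hα one_pos).mul_prod hg).const_mul C).mono'
      ((Measurable.aestronglyMeasurable (by fun_prop)).smul
        ((measurable_besselPsi hα).aestronglyMeasurable.smul hgm.comp_snd)) ?_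
    filter_upwards [Measure.quasiMeasurePreserving_fst.ae (ae_besselMeasure_pos α),
      Measure.quasiMeasurePreserving_snd.ae (ae_besselMeasure_pos α)] with z h1 h2
    rw [norm_smul, norm_smul, Real.norm_of_nonneg (Real.exp_nonneg _), besselPsi_comm]
    have h3 := h z.1 z.2 h1 h2
    have h4 : Real.exp (-(a * z.1 ^ 2)) * Real.exp (A * z.1 ^ 2) ≤
        Real.exp (-(1 * z.1 ^ 2)) := by
      rw [← Real.exp_add]
      exact Real.exp_le_exp.2 (by nlinarith [sq_nonneg z.1])
    calc Real.exp (-(a * z.1 ^ 2)) * (‖besselPsi α z.2 z.1‖ * ‖g z.2‖)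
        ≤ Real.exp (-(a * z.1 ^ 2)) *
          (C * (Real.exp (A * z.1 ^ 2) * Real.exp (b * z.2 ^ 2)) * ‖g z.2‖) := by gcongr
      _ = C * ((Real.exp (-(a * z.1 ^ 2)) * Real.exp (A * z.1 ^ 2)) *
          (Real.exp (b * z.2 ^ 2) * ‖g z.2‖)) := by ring
      _ ≤ C * (Real.exp (-(1 * z.1 ^ 2)) * (Real.exp (b * z.2 ^ 2) * ‖g z.2‖)) := by gcongr
  simp_rw [← integral_smul]
  refine ⟨hint.integral_prod_left, ?_⟩
  rw [integral_integral_swap hint]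
  refine integral_congr_ae ?_
  filter_upwards [ae_besselMeasure_pos α] with x hx
  simp_rw [smul_smul]
  rw [integral_smul_const, integral_exp_neg_mul_besselPsi hα (by linarith) hx]

/-- This exhibits the kernel as the pointwise Hankel transform, evaluated at y, of exp (-t l²)
Ψ_l(x), ready for Fubini against Gaussians. -/
lemma besselKernel_eq_integral {α t x y : ℝ} (hx : 0 < x) (hy : 0 < y) :
    besselKernel α t x y =
      ∫ l, besselPsi α y l • (Real.exp (-(t * l ^ 2)) * besselPsi α l x) ∂(besselMeasure α) := by
  rw [besselKernel, besselKernel0, integral_besselMeasure, ← integral_const_mul]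
  refine setIntegral_congr_fun measurableSet_Ioi fun l hl => ?_
  have hl' : (0 : ℝ) < l := hl
  simp only [besselPsi0, besselPsi, smul_eq_mul, Real.sqrt_eq_rpow]
  rw [mul_comm l y, Real.mul_rpow hx.le hy.le, Real.mul_rpow hx.le hl'.le,
    Real.mul_rpow hy.le hl'.le, Real.mul_rpow hx.le hl'.le, Real.mul_rpow hy.le hl'.le]
  have e1 : ∀ u : ℝ, 0 < u → u ^ (-α) = u ^ (-(α + 1 / 2)) * u ^ (1 / 2 : ℝ) := fun u hu => by
    rw [← Real.rpow_add hu]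
    ring_nf
  have e2 : l ^ (2 * α + 1) * (l ^ (-α) * l ^ (-α)) = l ^ (1 / 2 : ℝ) * l ^ (1 / 2 : ℝ) := by
    rw [← Real.rpow_add hl', ← Real.rpow_add hl', ← Real.rpow_add hl']
    ring_nf
  rw [e1 x hx, e1 y hy, neg_mul]
  linear_combination -(x ^ (-(α + 1 / 2)) * x ^ (1 / 2 : ℝ) * y ^ (-(α + 1 / 2)) *
    y ^ (1 / 2 : ℝ) * Real.exp (-(t * l ^ 2)) * besselJ α (x * l) * besselJ α (y * l)) * e2

/-- Weber's second exponential integral, for almost every `y`. -/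
lemma besselKernel_ae_eq {α : ℝ} (hα : -1 < α) {t : ℝ} (ht : 0 < t) {x : ℝ} (hx : 0 < x) :
    besselKernel α t x =ᵐ[besselMeasure α] besselHeatKernel α t x := by
  -- The rate t/4 is spent twice, on the kernel bound and on the weight below; exp (-t l²/2)
  -- remains.
  obtain ⟨C, A, hC, hA, h⟩ := exists_bound_besselPsi hα (b := t / 4) (by positivity)
  have hgm : Measurable fun l => Real.exp (-(t * l ^ 2)) * besselPsi α l x :=
    Measurable.mul (by fun_prop) ((measurable_besselPsi hα).comp (by fun_prop : Measurable
      fun l : ℝ => (l, x)))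
  have hg : Integrable (fun l => Real.exp (t / 4 * l ^ 2) *
      ‖Real.exp (-(t * l ^ 2)) * besselPsi α l x‖) (besselMeasure α) := by
    refine ((integrable_exp_neg_mul_sq_besselMeasure hα (a := t / 2) (by positivity)).const_mul
      (C * Real.exp (A * x ^ 2))).mono'
      (Measurable.mul (by fun_prop) hgm.norm).aestronglyMeasurable ?_
    filter_upwards [ae_besselMeasure_pos α] with l hl
    rw [Real.norm_of_nonneg (by positivity), norm_mul, Real.norm_of_nonneg (Real.exp_nonneg _)]
    have h4 : Real.exp (t / 4 * l ^ 2) * Real.exp (-(t * l ^ 2)) * Real.exp (t / 4 * l ^ 2) =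
        Real.exp (-(t / 2 * l ^ 2)) := by
      rw [← Real.exp_add, ← Real.exp_add]
      ring_nf
    calc Real.exp (t / 4 * l ^ 2) * (Real.exp (-(t * l ^ 2)) * ‖besselPsi α l x‖)
        ≤ Real.exp (t / 4 * l ^ 2) * (Real.exp (-(t * l ^ 2)) *
          (C * (Real.exp (A * x ^ 2) * Real.exp (t / 4 * l ^ 2)))) := by
          gcongr
          exact h x l hx hl
      _ = _ := by rw [← h4]; ring
  obtain ⟨c, hc, hfub⟩ := exists_integral_exp_neg_mul_integral_besselPsi hα (by positivity)
    hgm.aestronglyMeasurable hg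
  have hR : ∀ a : ℝ, 0 ≤ a → Integrable (fun y => Real.exp (-(a * y ^ 2)) •
      besselHeatKernel α t x y) (besselMeasure α) := fun a ha =>
    integrable_exp_neg_mul_besselHeatKernel hα ht ha x
  have key := ae_eq_zero_of_integral_exp_neg_sq (𝕜 := ℝ) (ae_besselMeasure_pos α) (c := c)
    (F := fun y => ∫ l, besselPsi α y l • (Real.exp (-(t * l ^ 2)) * besselPsi α l x)
      ∂(besselMeasure α) - besselHeatKernel α t x y)
    (by simp_rw [smul_sub]; exact (hfub c le_rfl).1.sub (hR c hc.le))
    (fun a ha => by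
      have ha0 : 0 < a := hc.trans_le ha
      simp_rw [smul_sub]
      rw [integral_sub (hfub a ha).1 (hR a ha0.le), (hfub a ha).2, sub_eq_zero]
      simp_rw [smul_eq_mul]
      rw [integral_exp_neg_mul_besselHeatKernel hα ht ha0.le]
      -- A second use of Weber's first integral, now with parameter t + 1/(4a); the prefactors match
      -- as 2a · 2(t + 1/(4a)) = 1 + 4at.
      have h4 : ∀ l, (2 * a) ^ (-α - 1) * Real.exp (-(1 / (4 * a) * l ^ 2)) *
          (Real.exp (-(t * l ^ 2)) * besselPsi α l x) =
          (2 * a) ^ (-α - 1) * (Real.exp (-((t + 1 / (4 * a)) * l ^ 2)) * besselPsi α l x) := by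
        intro l
        rw [show -((t + 1 / (4 * a)) * l ^ 2) = -(1 / (4 * a) * l ^ 2) + -(t * l ^ 2) by ring,
          Real.exp_add]
        ring
      simp_rw [h4]
      rw [integral_const_mul, integral_exp_neg_mul_besselPsi hα (by positivity) hx, ← mul_assoc,
        ← Real.mul_rpow (by positivity) (by positivity)]
      congr 3
      · field_simp
        ring
      · field_simp
        ring)
  filter_upwards [key, ae_besselMeasure_pos α] with y hy hy0
  rw [besselKernel_eq_integral hx hy0]
  exact sub_eq_zero.1 hy

/-! ### The Hankel transform on L² -/

section HankelL2

variable {𝕜 : Type*} [RCLike 𝕜]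

/-- By sesquilinearity only the Gram matrix matters; this reduces Plancherel on the span to pairs of
Gaussians. -/
lemma inner_linearCombination_eq {ι E : Type*} [NormedAddCommGroup E] [InnerProductSpace 𝕜 E]
    {v w v' w' : ι → E} (h : ∀ i j, inner 𝕜 (v i) (w j) = inner 𝕜 (v' i) (w' j)) (c d : ι →₀ 𝕜) :
    inner 𝕜 (Finsupp.linearCombination 𝕜 v c) (Finsupp.linearCombination 𝕜 w d) =
      inner 𝕜 (Finsupp.linearCombination 𝕜 v' c) (Finsupp.linearCombination 𝕜 w' d) := by
  induction c using Finsupp.induction_linear with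
  | zero => simp
  | add c₁ c₂ h₁ h₂ => simp only [map_add, inner_add_left, h₁, h₂]
  | single i r =>
    induction d using Finsupp.induction_linear with
    | zero => simp
    | add d₁ d₂ h₁ h₂ => simp only [map_add, inner_add_right, h₁, h₂]
    | single j s =>
      simp only [Finsupp.linearCombination_single, inner_smul_left, inner_smul_right, h]

lemma memLp_two_exp_neg {α : ℝ} (hα : -1 < α) {a : ℝ} (ha : 0 < a) :
    MemLp (fun x : ℝ => Real.exp (-(a * x ^ 2))) 2 (besselMeasure α) := by
  refine (memLp_two_iff_integrable_sq (Continuous.aestronglyMeasurable (by fun_prop))).2 ?_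
  refine (integrable_exp_neg_mul_sq_besselMeasure hα (a := 2 * a) (by positivity)).congr
    (.of_forall fun x => ?_)
  simp only [← Real.exp_nat_mul]
  push_cast
  ring_nf

lemma integrable_exp_neg_smul {α : ℝ} (hα : -1 < α) {a : ℝ} (ha : 0 < a) {f : ℝ → 𝕜}
    (hf : MemLp f 2 (besselMeasure α)) :
    Integrable (fun x => Real.exp (-(a * x ^ 2)) • f x) (besselMeasure α) := by
  have hm : AEStronglyMeasurable (fun x : ℝ => Real.exp (-(a * x ^ 2))) (besselMeasure α) :=
    Continuous.aestronglyMeasurable (by fun_prop)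
  refine (((memLp_two_exp_neg hα ha).integrable_norm_pow two_ne_zero).add
    (hf.integrable_norm_pow two_ne_zero)).mono' (hm.smul hf.1) (.of_forall fun x => ?_)
  rw [norm_smul, Pi.add_apply]
  nlinarith [sq_nonneg (‖Real.exp (-(a * x ^ 2))‖ - ‖f x‖), sq_nonneg ‖f x‖,
    sq_nonneg ‖Real.exp (-(a * x ^ 2))‖]

variable (𝕜) in
/-- The Gaussian `exp (-a x²)` as an element of `L²(μ_α)`; zero when it is not one. -/
def gaussianLp (α a : ℝ) : Lp 𝕜 2 (besselMeasure α) := by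
  classical
  exact if h : MemLp (fun x : ℝ => ((Real.exp (-(a * x ^ 2)) : ℝ) : 𝕜)) 2 (besselMeasure α) then
    h.toLp else 0

lemma coeFn_gaussianLp {α : ℝ} (hα : -1 < α) {a : ℝ} (ha : 0 < a) :
    gaussianLp 𝕜 α a =ᵐ[besselMeasure α] fun x : ℝ => ((Real.exp (-(a * x ^ 2)) : ℝ) : 𝕜) := by
  have h : MemLp (fun x : ℝ => ((Real.exp (-(a * x ^ 2)) : ℝ) : 𝕜)) 2 (besselMeasure α) :=
    (memLp_two_exp_neg hα ha).ofReal
  rw [gaussianLp, dif_pos h]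
  exact h.coeFn_toLp

lemma inner_gaussianLp {α : ℝ} (hα : -1 < α) {a : ℝ} (ha : 0 < a)
    (f : Lp 𝕜 2 (besselMeasure α)) :
    inner 𝕜 (gaussianLp 𝕜 α a) f = ∫ x, Real.exp (-(a * x ^ 2)) • f x ∂(besselMeasure α) := by
  rw [L2.inner_def]
  refine integral_congr_ae ?_
  filter_upwards [coeFn_gaussianLp (𝕜 := 𝕜) hα ha] with x hx
  rw [hx, RCLike.inner_apply', RCLike.conj_ofReal, RCLike.real_smul_eq_coe_mul]

lemma inner_gaussianLp_gaussianLp {α : ℝ} (hα : -1 < α) {a b : ℝ} (ha : 0 < a) (hb : 0 < b) :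
    inner 𝕜 (gaussianLp 𝕜 α a) (gaussianLp 𝕜 α b) =
      ((1 / 2 * (a + b) ^ (-α - 1) * Real.Gamma (α + 1) : ℝ) : 𝕜) := by
  rw [inner_gaussianLp hα ha, ← integral_exp_neg_mul_sq_besselMeasure hα (add_pos ha hb),
    ← integral_ofReal]
  refine integral_congr_ae ?_
  filter_upwards [coeFn_gaussianLp (𝕜 := 𝕜) hα hb] with x hx
  rw [hx, RCLike.real_smul_eq_coe_mul, ← RCLike.ofReal_mul, ← Real.exp_add]
  ring_nf

lemma ae_eq_zero_of_inner_gaussianLp {α : ℝ} (hα : -1 < α) (f : Lp 𝕜 2 (besselMeasure α))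
    (h : ∀ a, 0 < a → inner 𝕜 (gaussianLp 𝕜 α a) f = 0) : f = 0 := by
  rw [Lp.eq_zero_iff_ae_eq_zero]
  refine ae_eq_zero_of_integral_exp_neg_sq (ae_besselMeasure_pos α) (c := 1)
    (integrable_exp_neg_smul hα one_pos (Lp.memLp f)) fun a ha => ?_
  rw [← inner_gaussianLp hα (zero_lt_one.trans_le ha), h a (zero_lt_one.trans_le ha)]

variable (𝕜) in
/-- Finite linear combinations of Gaussians. -/
def gaussianComb (α : ℝ) : (Ioi (0 : ℝ) →₀ 𝕜) →ₗ[𝕜] Lp 𝕜 2 (besselMeasure α) :=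
  Finsupp.linearCombination 𝕜 fun a : Ioi (0 : ℝ) => gaussianLp 𝕜 α a

variable (𝕜) in
/-- The Hankel transforms of finite linear combinations of Gaussians. -/
def gaussianHankelComb (α : ℝ) : (Ioi (0 : ℝ) →₀ 𝕜) →ₗ[𝕜] Lp 𝕜 2 (besselMeasure α) :=
  Finsupp.linearCombination 𝕜 fun a : Ioi (0 : ℝ) =>
    (((2 * (a : ℝ)) ^ (-α - 1) : ℝ) : 𝕜) • gaussianLp 𝕜 α (1 / (4 * a))

lemma denseRange_gaussianComb {α : ℝ} (hα : -1 < α) : DenseRange (gaussianComb 𝕜 α) := by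
  have h : (LinearMap.range (gaussianComb 𝕜 α))ᗮ = ⊥ := by
    refine (Submodule.eq_bot_iff _).2 fun f hf => ae_eq_zero_of_inner_gaussianLp hα f fun a ha => ?_
    refine (Submodule.mem_orthogonal _ f).1 hf _ ⟨Finsupp.single ⟨a, ha⟩ 1, ?_⟩
    simp [gaussianComb]
  have h2 := Submodule.topologicalClosure_eq_top_iff.2 h
  rw [DenseRange, ← LinearMap.coe_range]
  exact Submodule.dense_iff_topologicalClosure_eq_top.2 h2

/-- Plancherel on Gaussians: the Gram matrices agree because 2a · 2b · (1/(4a) + 1/(4b)) = a + b. -/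
lemma norm_gaussianHankelComb {α : ℝ} (hα : -1 < α) (c : Ioi (0 : ℝ) →₀ 𝕜) :
    ‖gaussianHankelComb 𝕜 α c‖ = ‖gaussianComb 𝕜 α c‖ := by
  rw [@norm_eq_sqrt_re_inner 𝕜, @norm_eq_sqrt_re_inner 𝕜]
  congr 2
  refine inner_linearCombination_eq (fun ⟨a, ha⟩ ⟨b, hb⟩ => ?_) c c
  have ha' : (0 : ℝ) < a := ha
  have hb' : (0 : ℝ) < b := hb
  simp only
  rw [inner_smul_left, inner_smul_right, RCLike.conj_ofReal,
    inner_gaussianLp_gaussianLp hα (by positivity) (by positivity),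
    inner_gaussianLp_gaussianLp hα ha' hb', ← RCLike.ofReal_mul, ← RCLike.ofReal_mul]
  congr 1
  rw [show a + b = 2 * a * (2 * b * (1 / (4 * a) + 1 / (4 * b))) by field_simp; ring,
    Real.mul_rpow (x := 2 * a) (by positivity) (by positivity),
    Real.mul_rpow (x := 2 * b) (by positivity) (by positivity)]
  ring

variable (𝕜) in
/-- The Hankel transform on `L²(μ_α)` as a continuous linear map. -/
def hankelL2 (α : ℝ) : Lp 𝕜 2 (besselMeasure α) →L[𝕜] Lp 𝕜 2 (besselMeasure α) :=
  (gaussianHankelComb 𝕜 α).extendOfNorm (gaussianComb 𝕜 α)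

lemma hankelL2_gaussianComb {α : ℝ} (hα : -1 < α) (c : Ioi (0 : ℝ) →₀ 𝕜) :
    hankelL2 𝕜 α (gaussianComb 𝕜 α c) = gaussianHankelComb 𝕜 α c := by
  unfold hankelL2
  exact LinearMap.extendOfNorm_eq (denseRange_gaussianComb (𝕜 := 𝕜) hα)
    ⟨1, fun c => by rw [one_mul, norm_gaussianHankelComb hα]⟩ c

lemma norm_hankelL2_le {α : ℝ} (hα : -1 < α) (f : Lp 𝕜 2 (besselMeasure α)) :
    ‖hankelL2 𝕜 α f‖ ≤ ‖f‖ := by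
  unfold hankelL2
  simpa using LinearMap.norm_extendOfNorm_apply_le (denseRange_gaussianComb (𝕜 := 𝕜) hα) 1
    (fun c => by rw [one_mul, norm_gaussianHankelComb hα]) f

lemma hankelL2_gaussianLp {α : ℝ} (hα : -1 < α) {a : ℝ} (ha : 0 < a) :
    hankelL2 𝕜 α (gaussianLp 𝕜 α a) =
      (((2 * a) ^ (-α - 1) : ℝ) : 𝕜) • gaussianLp 𝕜 α (1 / (4 * a)) := by
  simpa [gaussianComb, gaussianHankelComb] using
    hankelL2_gaussianComb (𝕜 := 𝕜) hα (Finsupp.single ⟨a, ha⟩ 1)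

/-- The Hankel transform is an involution of `L²(μ_α)`. -/
lemma hankelL2_hankelL2 {α : ℝ} (hα : -1 < α) (f : Lp 𝕜 2 (besselMeasure α)) :
    hankelL2 𝕜 α (hankelL2 𝕜 α f) = f := by
  refine (denseRange_gaussianComb hα).induction_on f (isClosed_eq (by fun_prop) (by fun_prop))
    fun c => ?_
  rw [hankelL2_gaussianComb hα]
  induction c using Finsupp.induction_linear with
  | zero => simp
  | add c₁ c₂ h₁ h₂ => rw [map_add, map_add, map_add, h₁, h₂]
  | single a r =>
    obtain ⟨a, ha⟩ := a
    have ha' : (0 : ℝ) < a := ha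
    simp only [gaussianComb, gaussianHankelComb, Finsupp.linearCombination_single, map_smul]
    rw [hankelL2_gaussianLp hα (by positivity), smul_smul (((2 * a) ^ (-α - 1) : ℝ) : 𝕜),
      ← RCLike.ofReal_mul, ← Real.mul_rpow (by positivity) (by positivity),
      show 2 * a * (2 * (1 / (4 * a))) = 1 by field_simp; norm_num, Real.one_rpow,
      show 1 / (4 * (1 / (4 * a))) = a by field_simp]
    simp

/-- Symmetry of the transform. By density f may be a Gaussian with parameter b, where it reads 2b(a
+ 1/(4b)) = 2a(1/(4a) + b). -/
lemma inner_gaussianLp_hankelL2 {α : ℝ} (hα : -1 < α) {a : ℝ} (ha : 0 < a)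
    (f : Lp 𝕜 2 (besselMeasure α)) :
    inner 𝕜 (gaussianLp 𝕜 α a) (hankelL2 𝕜 α f) =
      (((2 * a) ^ (-α - 1) : ℝ) : 𝕜) * inner 𝕜 (gaussianLp 𝕜 α (1 / (4 * a))) f := by
  refine (denseRange_gaussianComb hα).induction_on f (isClosed_eq (by fun_prop) (by fun_prop))
    fun c => ?_
  rw [hankelL2_gaussianComb hα]
  induction c using Finsupp.induction_linear with
  | zero => simp
  | add c₁ c₂ h₁ h₂ => rw [map_add, map_add, inner_add_right, inner_add_right, h₁, h₂, mul_add]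
  | single b r =>
    obtain ⟨b, hb⟩ := b
    have hb' : (0 : ℝ) < b := hb
    simp only [gaussianComb, gaussianHankelComb, Finsupp.linearCombination_single,
      inner_smul_right]
    rw [inner_gaussianLp_gaussianLp hα ha (by positivity),
      inner_gaussianLp_gaussianLp hα (by positivity) hb',
      ← RCLike.ofReal_mul, mul_left_comm _ r, ← RCLike.ofReal_mul]
    congr 2
    have h1 : (2 * b) * (a + 1 / (4 * b)) = (2 * a) * (1 / (4 * a) + b) := by field_simp; ring
    have h2 : (2 * b * (a + 1 / (4 * b))) ^ (-α - 1) = (2 * a * (1 / (4 * a) + b)) ^ (-α - 1) := by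
      rw [h1]
    rw [Real.mul_rpow (x := 2 * b) (by positivity) (by positivity),
      Real.mul_rpow (x := 2 * a) (by positivity) (by positivity)] at h2
    linear_combination 1 / 2 * Real.Gamma (α + 1) * h2

/-- Dominated convergence in `L²` for bounded multipliers. -/
lemma tendsto_eLpNorm_two_smul_zero {X ι : Type*} [MeasurableSpace X] {μ : Measure X}
    {l : Filter ι} [l.IsCountablyGenerated] {m : ι → X → ℝ} {f : X → 𝕜} (hf : MemLp f 2 μ)
    (hm : ∀ i, Measurable (m i)) (hb : ∀ i x, ‖m i x‖ ≤ 1)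
    (hl : ∀ᵐ x ∂μ, Tendsto (fun i => m i x) l (𝓝 0)) :
    Tendsto (fun i => eLpNorm (fun x => m i x • f x) 2 μ) l (𝓝 0) := by
  wlog hfm : StronglyMeasurable f generalizing f
  · refine (this (hf.ae_eq hf.1.ae_eq_mk) hf.1.stronglyMeasurable_mk).congr fun i =>
      eLpNorm_congr_ae ?_
    filter_upwards [hf.1.ae_eq_mk] with x hx
    rw [hx]
  have hnorm : ∀ g : X → 𝕜, eLpNorm g 2 μ = (∫⁻ x, ‖g x‖ₑ ^ (2 : ℝ) ∂μ) ^ (1 / 2 : ℝ) := fun g => by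
    simp [eLpNorm_eq_lintegral_rpow_enorm_toReal]
  simp_rw [hnorm]
  have key : Tendsto (fun i => ∫⁻ x, ‖m i x • f x‖ₑ ^ (2 : ℝ) ∂μ) l (𝓝 (∫⁻ _, 0 ∂μ)) := by
    refine tendsto_lintegral_filter_of_dominated_convergence (fun x => ‖f x‖ₑ ^ (2 : ℝ))
      (.of_forall fun i => ?_) (.of_forall fun i => .of_forall fun x => ?_) ?_ ?_
    · exact ((hm i).smul hfm.measurable).enorm.pow_const _
    · refine ENNReal.rpow_le_rpow ?_ two_pos.le
      rw [enorm_smul]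
      refine mul_le_of_le_one_left' ?_
      rw [← ofReal_norm]
      exact ENNReal.ofReal_le_one.2 (hb i x)
    · have := lintegral_rpow_enorm_lt_top_of_eLpNorm_lt_top two_ne_zero ENNReal.ofNat_ne_top hf.2
      simpa using this.ne
    · filter_upwards [hl] with x hx
      have h1 : Tendsto (fun i => m i x • f x) l (𝓝 ((0 : ℝ) • f x)) := hx.smul_const (f x)
      have h2 := (ENNReal.continuous_rpow_const (y := 2)).tendsto _ |>.comp h1.enorm
      simpa [Function.comp_def] using h2
  have h3 := ((ENNReal.continuous_rpow_const (y := (1 / 2 : ℝ))).tendsto _).comp key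
  simpa [Function.comp_def] using h3

/-- On (0, R], exp (x²) ≤ exp (2R²) exp (-x²), and f is integrable against a Gaussian. -/
lemma integrable_exp_mul_norm_indicator {α : ℝ} (hα : -1 < α) {f : ℝ → 𝕜}
    (hf : MemLp f 2 (besselMeasure α)) (R : ℝ) :
    Integrable (fun x => Real.exp (1 * x ^ 2) * ‖(Ioc 0 R).indicator f x‖) (besselMeasure α) := by
  refine ((integrable_exp_neg_smul hα one_pos hf).norm.const_mul (Real.exp (2 * R ^ 2))).mono'
    ((Continuous.aestronglyMeasurable (by fun_prop)).mul
      (hf.1.indicator measurableSet_Ioc).norm) (.of_forall fun x => ?_)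
  rw [Real.norm_of_nonneg (by positivity)]
  by_cases hx : x ∈ Ioc 0 R
  · rw [indicator_of_mem hx, norm_smul, Real.norm_of_nonneg (Real.exp_nonneg _), ← mul_assoc,
      ← Real.exp_add]
    gcongr
    nlinarith [hx.1, hx.2]
  · rw [indicator_of_notMem hx, norm_zero, mul_zero]
    positivity

/-- On functions in `L²(μ_α)` with bounded support, the Hankel transform is given by the
integral. -/
lemma modHankelTrunc_ae_eq {α : ℝ} (hα : -1 < α) {f : ℝ → 𝕜} (hf : MemLp f 2 (besselMeasure α))
    (R : ℝ) : modHankelTrunc α R f =ᵐ[besselMeasure α]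
      hankelL2 𝕜 α (hf.indicator (measurableSet_Ioc (a := 0) (b := R))).toLp := by
  have hg := hf.indicator (measurableSet_Ioc (a := 0) (b := R))
  set g := (Ioc 0 R).indicator f with hgdef
  have htr : modHankelTrunc α R f = fun l => ∫ x, besselPsi α l x • g x ∂(besselMeasure α) := by
    ext l
    rw [modHankelTrunc, ← integral_indicator measurableSet_Ioc]
    congr 1 with x
    by_cases hx : x ∈ Ioc 0 R <;> simp [hgdef, hx]
  obtain ⟨c, hc, hfub⟩ := exists_integral_exp_neg_mul_integral_besselPsi hα one_pos hg.1
    (integrable_exp_mul_norm_indicator hα hf R)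
  have hH := fun a (ha : 0 < a) =>
    integrable_exp_neg_smul hα ha (Lp.memLp (hankelL2 𝕜 α hg.toLp))
  -- Against exp (-a l²), both sides give (2a)^(-α-1) times the integral of g against the Gaussian
  -- with parameter 1/(4a): one by Fubini, the other by symmetry.
  have key := ae_eq_zero_of_integral_exp_neg_sq (ae_besselMeasure_pos α) (c := c)
    (F := fun l => ∫ x, besselPsi α l x • g x ∂(besselMeasure α) - hankelL2 𝕜 α hg.toLp l)
    (by simp_rw [smul_sub]; exact (hfub c le_rfl).1.sub (hH c hc))
    (fun a ha => by
      have ha0 : 0 < a := hc.trans_le ha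
      simp_rw [smul_sub]
      rw [integral_sub (hfub a ha).1 (hH a ha0), (hfub a ha).2, sub_eq_zero,
        ← inner_gaussianLp hα ha0, inner_gaussianLp_hankelL2 hα ha0,
        inner_gaussianLp hα (by positivity), ← integral_const_mul]
      refine integral_congr_ae ?_
      filter_upwards [hg.coeFn_toLp] with x hx
      rw [hx, mul_smul, RCLike.real_smul_eq_coe_mul])
  rw [htr]
  filter_upwards [key] with l hl
  exact sub_eq_zero.1 hl

/-- The error is the transform of minus the tail of f; contractivity bounds it by the L² norm of the
tail. -/
lemma isModHankel_hankelL2 {α : ℝ} (hα : -1 < α) {f : ℝ → 𝕜} (hf : MemLp f 2 (besselMeasure α)) :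
    IsModHankel α f (hankelL2 𝕜 α hf.toLp) := by
  refine ⟨Lp.memLp _, ?_⟩
  have hlim : Tendsto (fun R : ℝ => eLpNorm
      (fun x => (Ioc 0 R)ᶜ.indicator (fun _ => (-1 : ℝ)) x • f x) 2 (besselMeasure α))
      atTop (𝓝 0) := by
    refine tendsto_eLpNorm_two_smul_zero hf (fun R => ?_) (fun R x => ?_) ?_
    · exact measurable_const.indicator measurableSet_Ioc.compl
    · by_cases hx : x ∈ (Ioc 0 R)ᶜ <;> simp [hx]
    · filter_upwards [ae_besselMeasure_pos α] with x hx
      refine tendsto_const_nhds.congr' ?_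
      filter_upwards [eventually_ge_atTop x] with R hR
      rw [indicator_of_notMem (by simpa using ⟨hx, hR⟩)]
  refine tendsto_of_tendsto_of_tendsto_of_le_of_le tendsto_const_nhds hlim
    (fun _ => zero_le) fun R => ?_
  have hg := hf.indicator (measurableSet_Ioc (a := 0) (b := R))
  have h1 : modHankelTrunc α R f - ⇑(hankelL2 𝕜 α hf.toLp) =ᵐ[besselMeasure α]
      hankelL2 𝕜 α (hg.toLp - hf.toLp) := by
    rw [map_sub]
    exact ((modHankelTrunc_ae_eq hα hf R).sub .rfl).trans (Lp.coeFn_sub _ _).symm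
  have h2 : (fun x => (Ioc 0 R)ᶜ.indicator (fun _ => (-1 : ℝ)) x • f x) =ᵐ[besselMeasure α]
      (hg.toLp - hf.toLp : Lp 𝕜 2 (besselMeasure α)) := by
    filter_upwards [Lp.coeFn_sub hg.toLp hf.toLp, hg.coeFn_toLp, hf.coeFn_toLp] with x h3 h4 h5
    rw [h3, Pi.sub_apply, h4, h5]
    by_cases hx : x ∈ Ioc 0 R <;> simp [indicator, hx]
  simp only
  rw [eLpNorm_congr_ae h1, eLpNorm_congr_ae h2, ← Lp.enorm_def, ← Lp.enorm_def]
  exact enorm_le_iff_norm_le.2 (norm_hankelL2_le hα _)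

lemma isModHankel_modHankel {α : ℝ} (hα : -1 < α) {f : ℝ → 𝕜}
    (hf : MemLp f 2 (besselMeasure α)) : IsModHankel α f (modHankel α f) := by
  have h : ∃ g, IsModHankel α f g := ⟨_, isModHankel_hankelL2 hα hf⟩
  rw [modHankel, dif_pos h]
  exact h.choose_spec

lemma aestronglyMeasurable_modHankelTrunc {α : ℝ} (hα : -1 < α) {f : ℝ → 𝕜}
    (hf : MemLp f 2 (besselMeasure α)) (R : ℝ) :
    AEStronglyMeasurable (modHankelTrunc α R f) (besselMeasure α) :=
  (Lp.aestronglyMeasurable _).congr (modHankelTrunc_ae_eq hα hf R).symm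

/-- Uniqueness of L² limits; it makes the choice inside `modHankel` harmless. -/
lemma IsModHankel.ae_eq {α : ℝ} (hα : -1 < α) {f g h : ℝ → 𝕜}
    (hf : MemLp f 2 (besselMeasure α)) (hg : IsModHankel α f g) (hh : IsModHankel α f h) :
    g =ᵐ[besselMeasure α] h := by
  have hm := aestronglyMeasurable_modHankelTrunc hα hf
  have h0 : eLpNorm (g - h) 2 (besselMeasure α) = 0 := by
    refine le_antisymm (ge_of_tendsto (by simpa using hg.2.add hh.2)
      (.of_forall fun R => ?_)) zero_le
    rw [eLpNorm_sub_comm _ g]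
    refine (eLpNorm_add_le (hg.1.1.sub (hm R)) ((hm R).sub hh.1.1) one_le_two).trans' ?_
    rw [sub_add_sub_cancel]
  rw [eLpNorm_eq_zero_iff (hg.1.1.sub hh.1.1) two_ne_zero] at h0
  exact (sub_ae_eq_zero _ _).1 h0

lemma modHankel_ae_eq {α : ℝ} (hα : -1 < α) {f : ℝ → 𝕜} {F : Lp 𝕜 2 (besselMeasure α)}
    (hF : f =ᵐ[besselMeasure α] F) : modHankel α f =ᵐ[besselMeasure α] hankelL2 𝕜 α F := by
  have hf : MemLp f 2 (besselMeasure α) := (Lp.memLp F).ae_eq hF.symm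
  have hFf : F = hf.toLp := Lp.ext (hF.symm.trans hf.coeFn_toLp.symm)
  rw [hFf]
  exact (isModHankel_modHankel hα hf).ae_eq hα hf (isModHankel_hankelL2 hα hf)

end HankelL2

/-! ### The Bessel heat semigroup -/

section BesselHeat

variable {𝕜 : Type*} [RCLike 𝕜]

lemma besselHeat_eq_kernelOp {α : ℝ} (hα : -1 < α) {t : ℝ≥0} (ht : 0 < t) (f : ℝ → 𝕜) {x : ℝ}
    (hx : 0 < x) :
    besselHeat α t f x = kernelOp (besselMeasure α) (besselHeatKernel α t) f x := by
  rw [besselHeat, if_neg ht.ne', kernelOp]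
  refine integral_congr_ae ?_
  filter_upwards [besselKernel_ae_eq hα (NNReal.coe_pos.2 ht) hx] with y hy
  rw [hy]

lemma besselHeat_ae_eq_kernelOp {α : ℝ} (hα : -1 < α) {t : ℝ≥0} (ht : 0 < t) (f : ℝ → 𝕜) :
    besselHeat α t f =ᵐ[besselMeasure α]
      kernelOp (besselMeasure α) (besselHeatKernel α t) f := by
  filter_upwards [ae_besselMeasure_pos α] with x hx
  exact besselHeat_eq_kernelOp hα ht f hx

lemma besselHeat_zero (α : ℝ) (f : ℝ → 𝕜) : besselHeat α 0 f = f := by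
  rw [besselHeat, if_pos rfl]

lemma integrable_besselKernel_smul {α : ℝ} (hα : -1 < α) {t : ℝ} (ht : 0 < t) {f : ℝ → 𝕜}
    (hf : MemL1AddLinf (besselMeasure α) f) {x : ℝ} (hx : 0 < x) :
    Integrable (fun y => besselKernel α t x y • f y) (besselMeasure α) := by
  refine ((isSymmMarkovKernel_besselHeatKernel hα ht).integrable_smul hf x).congr ?_
  filter_upwards [besselKernel_ae_eq hα ht hx] with y hy
  rw [hy]

lemma besselHeat_congr_ae {α : ℝ} (t : ℝ≥0) {f g : ℝ → 𝕜}
    (h : f =ᵐ[besselMeasure α] g) : besselHeat α t f =ᵐ[besselMeasure α] besselHeat α t g := by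
  rcases eq_or_ne t 0 with rfl | ht
  · simpa only [besselHeat_zero] using h
  · refine .of_forall fun x => ?_
    rw [besselHeat, besselHeat, if_neg ht, if_neg ht]
    refine integral_congr_ae ?_
    filter_upwards [h] with y hy
    rw [hy]

lemma norm_exp_neg_mul_sq_le_one (t : ℝ≥0) (l : ℝ) : ‖Real.exp (-t * l ^ 2)‖ ≤ 1 := by
  rw [Real.norm_of_nonneg (Real.exp_nonneg _), neg_mul]
  exact Real.exp_le_one_iff.2 (neg_nonpos.2 (by positivity))

lemma memLp_exp_neg_mul_sq_smul {α : ℝ} (t : ℝ≥0) (F : Lp 𝕜 2 (besselMeasure α)) :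
    MemLp (fun l => Real.exp (-t * l ^ 2) • F l) 2 (besselMeasure α) := by
  refine (Lp.memLp F).of_le ((Continuous.aestronglyMeasurable (by fun_prop)).smul
    (Lp.aestronglyMeasurable F)) (.of_forall fun l => ?_)
  rw [norm_smul]
  exact mul_le_of_le_one_left (norm_nonneg _) (norm_exp_neg_mul_sq_le_one t l)

/-- Multiplication by `exp (-t l²)` on `L²(μ_α)`. -/
def gaussianMul {α : ℝ} (t : ℝ≥0) (F : Lp 𝕜 2 (besselMeasure α)) : Lp 𝕜 2 (besselMeasure α) :=
  (memLp_exp_neg_mul_sq_smul t F).toLp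

lemma coeFn_gaussianMul {α : ℝ} (t : ℝ≥0) (F : Lp 𝕜 2 (besselMeasure α)) :
    gaussianMul t F =ᵐ[besselMeasure α] fun l => Real.exp (-t * l ^ 2) • F l :=
  (memLp_exp_neg_mul_sq_smul t F).coeFn_toLp

lemma inner_gaussianLp_gaussianMul {α : ℝ} (hα : -1 < α) {a : ℝ} (ha : 0 < a) (t : ℝ≥0)
    (F : Lp 𝕜 2 (besselMeasure α)) :
    inner 𝕜 (gaussianLp 𝕜 α a) (gaussianMul t F) = inner 𝕜 (gaussianLp 𝕜 α (t + a)) F := by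
  rw [inner_gaussianLp hα ha, inner_gaussianLp hα (by positivity)]
  refine integral_congr_ae ?_
  filter_upwards [coeFn_gaussianMul t F] with x hx
  rw [hx, smul_smul, ← Real.exp_add]
  ring_nf

lemma besselHeatL2_ae_eq {α : ℝ} (hα : -1 < α) (t : ℝ≥0) {f : ℝ → 𝕜}
    (hf : MemLp f 2 (besselMeasure α)) :
    besselHeatL2 α t f =ᵐ[besselMeasure α]
      hankelL2 𝕜 α (gaussianMul t (hankelL2 𝕜 α hf.toLp)) := by
  refine modHankel_ae_eq hα ?_
  filter_upwards [modHankel_ae_eq hα hf.coeFn_toLp.symm,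
    coeFn_gaussianMul t (hankelL2 𝕜 α hf.toLp)] with l h1 h2
  rw [h1, h2]

lemma kernelOp_exp_neg {α : ℝ} (hα : -1 < α) {t : ℝ} (ht : 0 < t) {a : ℝ} (ha : 0 < a) (x : ℝ) :
    kernelOp (besselMeasure α) (besselHeatKernel α t)
        (fun y => ((Real.exp (-(a * y ^ 2)) : ℝ) : 𝕜)) x =
      (((1 + 4 * a * t) ^ (-α - 1) * Real.exp (-(a / (1 + 4 * a * t) * x ^ 2)) : ℝ) : 𝕜) := by
  rw [← integral_exp_neg_mul_besselHeatKernel hα ht ha.le, ← integral_ofReal, kernelOp]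
  congr 1 with y
  rw [RCLike.real_smul_eq_coe_mul, ← RCLike.ofReal_mul, mul_comm]

/-- The kernel operator and the spectrally defined operator agree on `L²(μ_α)`. -/
lemma kernelOp_ae_eq_hankelL2 {α : ℝ} (hα : -1 < α) {t : ℝ≥0} (ht : 0 < t) {f : ℝ → 𝕜}
    (hf : MemLp f 2 (besselMeasure α)) :
    kernelOp (besselMeasure α) (besselHeatKernel α t) f =ᵐ[besselMeasure α]
      hankelL2 𝕜 α (gaussianMul t (hankelL2 𝕜 α hf.toLp)) := by
  have ht' : (0 : ℝ) < t := NNReal.coe_pos.2 ht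
  have hk := isSymmMarkovKernel_besselHeatKernel hα ht'
  have hK := hk.memLp_kernelOp one_le_two hf
  suffices h : hK.toLp = hankelL2 𝕜 α (gaussianMul t (hankelL2 𝕜 α hf.toLp)) by
    rw [← h]
    exact hK.coeFn_toLp.symm
  rw [← sub_eq_zero]
  refine ae_eq_zero_of_inner_gaussianLp hα _ fun a ha => ?_
  have hga : MemLp (fun x : ℝ => ((Real.exp (-(a * x ^ 2)) : ℝ) : 𝕜)) 2 (besselMeasure α) :=
    (memLp_two_exp_neg hα ha).ofReal
  -- Self-adjointness moves the kernel operator onto the Gaussian, whose evolution is explicit.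
  have h1 : inner 𝕜 (gaussianLp 𝕜 α a) hK.toLp =
      ((1 + 4 * a * t) ^ (-α - 1) : ℝ) *
        inner 𝕜 (gaussianLp 𝕜 α (a / (1 + 4 * a * t))) hf.toLp := by
    rw [L2.inner_def, inner_gaussianLp hα (by positivity), ← integral_const_mul]
    refine Eq.trans (integral_congr_ae ?_)
      ((hk.integral_inner_kernelOp hga hf).symm.trans (integral_congr_ae ?_))
    · filter_upwards [coeFn_gaussianLp (𝕜 := 𝕜) hα ha, hK.coeFn_toLp] with x h2 h3
      rw [h2, h3]
    · filter_upwards [hf.coeFn_toLp] with x hx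
      rw [hx, kernelOp_exp_neg hα ht' ha, RCLike.inner_apply', RCLike.conj_ofReal,
        RCLike.ofReal_mul, mul_assoc, RCLike.real_smul_eq_coe_mul]
  -- On the spectral side the parameter moves through 1/(4a) and t + 1/(4a) to 1/(4(t + 1/(4a))) =
  -- a/(1+4at).
  rw [inner_sub_right, h1, inner_gaussianLp_hankelL2 hα ha,
    inner_gaussianLp_gaussianMul hα (by positivity), inner_gaussianLp_hankelL2 hα (by positivity),
    ← mul_assoc, ← RCLike.ofReal_mul, ← Real.mul_rpow (by positivity) (by positivity), sub_eq_zero,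
    show 1 / (4 * (t + 1 / (4 * a))) = a / (1 + 4 * a * t) by field_simp; ring,
    show 2 * a * (2 * (t + 1 / (4 * a))) = 1 + 4 * a * t by field_simp; ring]

/-- At t = 0 the multiplier is trivial and the claim is the involution property. -/
lemma besselHeat_ae_eq_hankelL2 {α : ℝ} (hα : -1 < α) (t : ℝ≥0) {f : ℝ → 𝕜}
    (hf : MemLp f 2 (besselMeasure α)) :
    besselHeat α t f =ᵐ[besselMeasure α]
      hankelL2 𝕜 α (gaussianMul t (hankelL2 𝕜 α hf.toLp)) := by
  rcases eq_or_ne t 0 with rfl | ht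
  · have h : gaussianMul 0 (hankelL2 𝕜 α hf.toLp) = hankelL2 𝕜 α hf.toLp := by
      refine Lp.ext ?_
      filter_upwards [coeFn_gaussianMul 0 (hankelL2 𝕜 α hf.toLp)] with l hl
      simpa using hl
    rw [besselHeat_zero, h, hankelL2_hankelL2 hα]
    exact hf.coeFn_toLp.symm
  · exact (besselHeat_ae_eq_kernelOp hα (pos_iff_ne_zero.2 ht) f).trans
      (kernelOp_ae_eq_hankelL2 hα (pos_iff_ne_zero.2 ht) hf)

/-- By the involution property the difference is the transform of (exp (-t l²) - 1) F, so
contractivity and dominated convergence suffice. -/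
lemma tendsto_eLpNorm_besselHeat_sub {α : ℝ} (hα : -1 < α) {f : ℝ → 𝕜}
    (hf : MemLp f 2 (besselMeasure α)) :
    Tendsto (fun t : ℝ≥0 => eLpNorm (besselHeat α t f - f) 2 (besselMeasure α)) (𝓝[>] 0)
      (𝓝 0) := by
  set F := hankelL2 𝕜 α hf.toLp with hF
  have hlim : Tendsto (fun t : ℝ≥0 => eLpNorm
      (fun l => (Real.exp (-t * l ^ 2) - 1) • F l) 2 (besselMeasure α)) (𝓝[>] 0) (𝓝 0) := by
    refine tendsto_eLpNorm_two_smul_zero (Lp.memLp F) (fun t => by fun_prop) (fun t l => ?_)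
      (.of_forall fun l => ?_)
    · have h1 := norm_exp_neg_mul_sq_le_one t l
      rw [Real.norm_of_nonneg (Real.exp_nonneg _)] at h1
      rw [Real.norm_eq_abs, abs_le]
      constructor <;> linarith [Real.exp_nonneg (-t * l ^ 2)]
    · have h2 : Continuous fun t : ℝ≥0 => Real.exp (-t * l ^ 2) - 1 := by fun_prop
      simpa using (h2.tendsto 0).mono_left nhdsWithin_le_nhds
  refine tendsto_of_tendsto_of_tendsto_of_le_of_le tendsto_const_nhds hlim
    (fun _ => zero_le) fun t => ?_
  have h1 : besselHeat α t f - f =ᵐ[besselMeasure α] hankelL2 𝕜 α (gaussianMul t F - F) := by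
    rw [map_sub, hF, hankelL2_hankelL2 hα]
    exact ((besselHeat_ae_eq_hankelL2 hα t hf).sub hf.coeFn_toLp.symm).trans
      (Lp.coeFn_sub _ _).symm
  have h2 : (fun l => (Real.exp (-t * l ^ 2) - 1) • F l) =ᵐ[besselMeasure α]
      (gaussianMul t F - F : Lp 𝕜 2 (besselMeasure α)) := by
    filter_upwards [Lp.coeFn_sub (gaussianMul t F) F, coeFn_gaussianMul t F] with l h3 h4
    rw [h3, Pi.sub_apply, h4, sub_smul, one_smul]
  simp only
  rw [eLpNorm_congr_ae h1, eLpNorm_congr_ae h2, ← Lp.enorm_def, ← Lp.enorm_def]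
  exact enorm_le_iff_norm_le.2 (norm_hankelL2_le hα _)

lemma besselHeat_add_time {α : ℝ} (hα : -1 < α) (s t : ℝ≥0) {f : ℝ → 𝕜}
    (hf : MemL1AddLinf (besselMeasure α) f) :
    besselHeat α (s + t) f =ᵐ[besselMeasure α] besselHeat α s (besselHeat α t f) := by
  rcases eq_or_ne s 0 with rfl | hs
  · rw [zero_add, besselHeat_zero]
  rcases eq_or_ne t 0 with rfl | ht
  · rw [add_zero, besselHeat_zero]
  have hs' := pos_iff_ne_zero.2 hs
  have ht' := pos_iff_ne_zero.2 ht
  have hs0 : (0 : ℝ) < s := NNReal.coe_pos.2 hs'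
  have ht0 : (0 : ℝ) < t := NNReal.coe_pos.2 ht'
  refine (besselHeat_ae_eq_kernelOp hα (add_pos hs' ht') f).trans
    (EventuallyEq.trans ?_ (besselHeat_congr_ae s (besselHeat_ae_eq_kernelOp hα ht' f).symm))
  refine EventuallyEq.trans (.of_forall fun x => ?_) (besselHeat_ae_eq_kernelOp hα hs' _).symm
  rw [NNReal.coe_add]
  exact (IsSymmMarkovKernel.kernelOp_kernelOp (isSymmMarkovKernel_besselHeatKernel hα hs0)
    (isSymmMarkovKernel_besselHeatKernel hα ht0)
    (isSymmMarkovKernel_besselHeatKernel hα (add_pos hs0 ht0))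
    (integral_besselHeatKernel_mul hα hs0 ht0 x) hf).symm

lemma isMarkovianSymmetricDiffusionSemigroup_besselHeat {α : ℝ} (hα : -1 < α) :
    IsMarkovianSymmetricDiffusionSemigroup (besselMeasure α)
      (besselHeat α : ℝ≥0 → (ℝ → 𝕜) → (ℝ → 𝕜)) := by
  have hk : ∀ t : ℝ≥0, t ≠ 0 → IsSymmMarkovKernel (besselMeasure α) (besselHeatKernel α t) :=
    fun t ht => isSymmMarkovKernel_besselHeatKernel hα (NNReal.coe_pos.2 (pos_iff_ne_zero.2 ht))
  have he : ∀ t : ℝ≥0, t ≠ 0 → ∀ f : ℝ → 𝕜, besselHeat α t f =ᵐ[besselMeasure α]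
      kernelOp (besselMeasure α) (besselHeatKernel α t) f :=
    fun t ht f => besselHeat_ae_eq_kernelOp hα (pos_iff_ne_zero.2 ht) f
  refine ⟨?_, ?_, ?_⟩
  · refine ⟨fun t f g _ h => besselHeat_congr_ae t h, ?_, ?_, ?_, ?_, ?_,
      fun s t p hp f hf => besselHeat_add_time hα s t (hf.memL1AddLinf hp), ?_,
      fun f hf => tendsto_eLpNorm_besselHeat_sub hα hf⟩
    · intro t f hf
      rcases eq_or_ne t 0 with rfl | ht
      · rw [besselHeat_zero]; exact hf.aestronglyMeasurable
      · exact ((hk t ht).aestronglyMeasurable_kernelOp hf.aestronglyMeasurable).congr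
          (he t ht f).symm
    · intro t f g hf hg
      rcases eq_or_ne t 0 with rfl | ht
      · simp only [besselHeat_zero]; rfl
      · refine (he t ht _).trans ?_
        rw [(hk t ht).kernelOp_add hf hg]
        exact ((he t ht f).add (he t ht g)).symm
    · intro t c f _
      rcases eq_or_ne t 0 with rfl | ht
      · simp only [besselHeat_zero]; rfl
      · refine .of_forall fun x => ?_
        rw [Pi.smul_apply, besselHeat, besselHeat, if_neg ht, if_neg ht, ← integral_smul]
        congr 1 with y
        rw [Pi.smul_apply, smul_comm]
    · intro f _
      rw [besselHeat_zero]
    · intro t p hp f hf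
      rcases eq_or_ne t 0 with rfl | ht
      · rw [besselHeat_zero]; exact ⟨hf, le_rfl⟩
      · rw [eLpNorm_congr_ae (he t ht f)]
        exact ⟨((hk t ht).memLp_kernelOp hp hf).ae_eq (he t ht f).symm,
          (hk t ht).eLpNorm_kernelOp_le hf.1 hp⟩
    · intro t f g hf hg
      rcases eq_or_ne t 0 with rfl | ht
      · simp only [besselHeat_zero]
      · have h := (hk t ht).integral_inner_kernelOp hf hg
        refine Eq.trans (integral_congr_ae ?_) (h.trans (integral_congr_ae ?_))
        · filter_upwards [he t ht f] with x hx
          rw [hx]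
        · filter_upwards [he t ht g] with x hx
          rw [hx]
  · intro t f hf h0
    rcases eq_or_ne t 0 with rfl | ht
    · rwa [besselHeat_zero]
    · filter_upwards [he t ht f] with x hx
      rw [hx]
      exact (hk t ht).kernelOp_nonneg hf h0 x
  · intro t
    rcases eq_or_ne t 0 with rfl | ht
    · rw [besselHeat_zero]
    · filter_upwards [he t ht fun _ => 1] with x hx
      rw [hx, (hk t ht).kernelOp_one]

end BesselHeat

end

/-- For `α > -1`, the Hankel transform `h_α` is well defined on `L²(μ_α)`; the heat kernel
integrals converge on `L¹ + L^∞` and extend the spectrally defined semigroup on `L²(μ_α)`; and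
the resulting family is a Markovian symmetric diffusion semigroup. -/
theorem mainTheorem9 {𝕜 : Type*} [RCLike 𝕜] (α : ℝ) (hα : -1 < α) :
    (∀ f : ℝ → 𝕜, MemLp f 2 (besselMeasure α) → IsModHankel α f (modHankel α f)) ∧
    (∀ t : ℝ≥0, 0 < t → ∀ f : ℝ → 𝕜, MemL1AddLinf (besselMeasure α) f → ∀ x : ℝ, 0 < x →
      Integrable (fun y => besselKernel α t x y • f y) (besselMeasure α)) ∧
    (∀ (t : ℝ≥0) (f : ℝ → 𝕜), MemLp f 2 (besselMeasure α) →
      besselHeat α t f =ᵐ[besselMeasure α] besselHeatL2 α t f) ∧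
    IsMarkovianSymmetricDiffusionSemigroup (besselMeasure α)
      (besselHeat α : ℝ≥0 → (ℝ → 𝕜) → (ℝ → 𝕜)) :=
  ⟨fun _ hf => isModHankel_modHankel hα hf,
    fun _ ht _ hf _ hx => integrable_besselKernel_smul hα (NNReal.coe_pos.2 ht) hf hx,
    fun t _ hf => (besselHeat_ae_eq_hankelL2 hα t hf).trans (besselHeatL2_ae_eq hα t hf).symm,
    isMarkovianSymmetricDiffusionSemigroup_besselHeat hα⟩
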